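/- **Notation.** $\mathcal B_\infty(x,r)\subset\mathbb R^2$ is the closed $\ell^\infty$-ball; $l^2(\mathbb Z^2)$ and $l^2_{\mathbb R}(\mathbb Z^2)$ are the complex and real square-summable sequences; $\overline V(x):=V(-x)$ for a sequence or a function $V$; $(Y\downarrow m)[n]:=Y[mn]$. For $\xi\in[-\pi,\pi]^2$ and $\kappa>0$, let $\mathcal G(\xi,\kappa)$ be the set of $\mathrm W\in l^2(\mathbb Z^2)$ whose discrete-time Fourier transform $\widehat{\mathrm W}(\omega)=\sum_n \mathrm W[n]e^{-i\langle\omega,n\rangle}\in L^2([-\pi,\pi]^2)$ is supported (a.e.) in $\mathcal B_\infty(\xi,\kappa/2)$. For $m,q\in\mathbb N^*$ and $\mathrm X\in l^2_{\mathbb R}(\mathbb Z^2)$ define $$\mathcal C_m\mathrm X:=|(\mathrm X*\overline{\mathrm W})\downarrow m|,\qquad \mathcal R_{m,q}\mathrm X[n]:=\max_{\|k\|_\infty\le q}\big((\mathrm X*\overline{\mathrm{Re}\,\mathrm W})\downarrow m\big)[2n+k].$$ Fix a sampling interval $s>0$ and let $\phi(x)=\frac1s\,\mathrm{sinc}(\pi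 x_1/s)\,\mathrm{sinc}(\pi x_2/s)$, where $\mathrm{sinc}(t)=\sin(t)/t$ and $\mathrm{sinc}(0)=1$. Put $F_{\mathrm X}(x):=\sum_n \mathrm X[n]\phi(x-sn)$, $\psi(x):=\sum_n\mathrm W[n]\phi(x-sn)$, and $T_u\mathrm X[n]:=s\,F_{\mathrm X}(sn-su)$ for $u\in\mathbb R^2$. Let $M_{\mathrm X}:=|F_{\mathrm X}*\overline\psi|$, let $H_{\mathrm X}\in[0,2\pi)$ be the argument of $F_{\mathrm X}*\overline\psi$, let $Z_{\mathrm X}:=e^{iH_{\mathrm X}}$, and put $$\delta_{m,q}\mathrm X[n]:=\mathcal C_{2m}\mathrm X[n]\Big(1-\max_{\|k\|_\infty\le q}\cos\big(m\langle\xi,k\rangle-H_{\mathrm X}(2msn)\big)\Big).$$ For $\zeta\in\mathbb R^2$ let $0=\theta_0\le\dots\le\theta_{N_q-1}<2\pi$, $N_q=(2q+1)^2$, be the arguments in $[0,2\pi)$ of the numbers $e^{i\langle\zeta,k\rangle}$, $k\in\{-q,\dots,q\}^2$, in ascending order with multiplicity; let $\theta_{N_q}:=2\pi$, $\delta_i(\zeta):=\theta_{i+1}-\theta_i$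 and $$\gamma_q(\zeta):=\sqrt{\frac32+\frac1{4\pi}\sum_{i=0}^{N_q-1}\Big(\sin\delta_i(\zeta)-8\sin\frac{\delta_i(\zeta)}2\Big)}.$$ **Theorem (shift invariance of RGPool outputs).** Let $m,q\in\mathbb N^*$, $\xi\in[-\pi,\pi]^2$, $\kappa>0$ and $\mathrm W\in\mathcal G(\xi,\kappa)$. Let $\mathrm X$ be a stochastic process indexed by $\mathbb Z^2$ whose realizations are elements of $l^2_{\mathbb R}(\mathbb Z^2)$. Assume: 1. (Hypothesis 1) for every $x\in\mathbb R^2$, $Z_{\mathrm X}(x)$ is uniformly distributed on the unit circle; 2. (Hypothesis 2) for every $n\in\mathbb N^*$ and $x,y_1,\dots,y_n\in\mathbb R^2$, the random vector $(M_{\mathrm X}(y_1),\dots,M_{\mathrm X}(y_n))$ is independent of $Z_{\mathrm X}(x)$; 3. (Conjecture 1, for the filter $\mathrm W$) $\beta_q:\mathbb R_+\to\mathbb R_+$ is a function with $\beta_q(t)=O(t)$ as $t\to0$ such that, for every (deterministic) $\mathrm Y\in l^2_{\mathbb R}(\mathbb Z^2)$, $$\|\mathcal C_{2m}\mathrm Y-\mathcal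 R_{m,q}\mathrm Y\|_2\le(1+\beta_q(m\kappa))\,\|\delta_{m,q}\mathrm Y\|_2 .$$ Let $u\in\mathbb R^2$. If $\kappa\le\pi/m$ and $\|u\|_1\le\pi/\kappa$, then $$\mathsf R_{\mathrm X,u}:=\frac{\|\mathcal R_{m,q}(T_u\mathrm X)-\mathcal R_{m,q}\mathrm X\|_2}{\|\mathcal C_{2m}\mathrm X\|_2}$$ is a random variable (with the convention that the quotient is $0$ if its denominator is $\infty$) and $$\mathbb E[\mathsf R_{\mathrm X,u}]\le 2\,(1+\beta_q(m\kappa))\,\gamma_q(m\xi)+\frac{\|\kappa u\|_1}2 .$$ -/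

import Mathlib

open MeasureTheory ProbabilityTheory Filter Topology Asymptotics
open scoped ENNReal Convolution

noncomputable section

namespace GaborPool

/-! Points of the plane are pairs, so that the norm of `ℝ × ℝ` is the sup norm and
`Metric.closedBall x r` is the square `B_∞(x, r)`. -/

/-- The standard scalar product of the plane. -/
def dot (x y : ℝ × ℝ) : ℝ := x.1 * y.1 + x.2 * y.2

/-- The `ℓ¹` norm of the plane. -/
def normOne (x : ℝ × ℝ) : ℝ := |x.1| + |x.2|

/-- An integer point of the plane, seen as a real point. -/
def toReal (n : ℤ × ℤ) : ℝ × ℝ := ((n.1 : ℝ), (n.2 : ℝ))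

/-- The argument of a complex number, in `[0, 2π)`. -/
def angle (z : ℂ) : ℝ := toIcoMod Real.two_pi_pos 0 z.arg

/-- The `ℓ²` norm of a two-dimensional real sequence, with value `∞` if it is not in `ℓ²`. -/
def l2norm (Y : ℤ × ℤ → ℝ) : ℝ≥0∞ := eLpNorm Y 2 Measure.count

/-! ### Gabor-like filters -/

/-- Lebesgue measure on the frequency domain `[-π, π]²`. -/
def freqMeasure : Measure (ℝ × ℝ) :=
  volume.restrict (Set.Icc (-Real.pi) Real.pi ×ˢ Set.Icc (-Real.pi) Real.pi)

/-- `What` is the discrete-time Fourier transform `ω ↦ ∑ₙ W[n] exp(-i⟨ω, n⟩)` of `W`: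
the series converges to it in `L²([-π, π]²)`. -/
def IsDTFT (W : ℤ × ℤ → ℂ) (What : ℝ × ℝ → ℂ) : Prop :=
  MemLp What 2 freqMeasure ∧
    Tendsto (fun S : Finset (ℤ × ℤ) =>
      eLpNorm (fun ω => What ω -
        ∑ n ∈ S, W n * Complex.exp (-(Complex.I * (dot ω (toReal n) : ℂ)))) 2 freqMeasure)
      atTop (𝓝 0)

/-- The set of square-summable sequences whose Fourier transform is supported (up to a null set)
in the square of side `κ` centred at `ξ`. -/
def gaborFilters (ξ : ℝ × ℝ) (κ : ℝ) : Set (ℤ × ℤ → ℂ) :=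
  {W | Memℓp W 2 ∧ ∃ What : ℝ × ℝ → ℂ, IsDTFT W What ∧
    ∀ᵐ ω ∂freqMeasure, ω ∉ Metric.closedBall ξ (κ / 2) → What ω = 0}

/-! ### Discrete operators -/

/-- Discrete convolution. -/
def conv {E : Type*} [NormedAddCommGroup E] [NormedSpace ℝ E]
    (X : ℤ × ℤ → ℝ) (V : ℤ × ℤ → E) (n : ℤ × ℤ) : E :=
  ∑' k, X k • V (n - k)

/-- The flipped sequence or function. -/
def flip {A E : Type*} [Neg A] (V : A → E) (n : A) : E := V (-n)

/-- Subsampling by a factor `m`. -/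
def down {E : Type*} (m : ℕ) (Y : ℤ × ℤ → E) (n : ℤ × ℤ) : E := Y (m • n)

/-- The grid `{-q, …, q}²`. -/
def grid (q : ℕ) : Finset (ℤ × ℤ) := Finset.Icc (-(q : ℤ)) q ×ˢ Finset.Icc (-(q : ℤ)) q

theorem grid_nonempty (q : ℕ) : (grid q).Nonempty :=
  ⟨(0, 0), by simp [grid]⟩

/-- The maximum of a real function over the grid `{-q, …, q}²`. -/
def gridMax (q : ℕ) (a : ℤ × ℤ → ℝ) : ℝ := (grid q).sup' (grid_nonempty q) a

/-- Max pooling over a sliding grid of size `(2q+1) × (2q+1)`, with subsampling factor `2`. -/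
def maxpool (q : ℕ) (Y : ℤ × ℤ → ℝ) (n : ℤ × ℤ) : ℝ := gridMax q fun k => Y (2 • n + k)

/-- The modulus operator `X ↦ |(X * W̄) ↓ m|`. -/
def cgmod (m : ℕ) (W : ℤ × ℤ → ℂ) (X : ℤ × ℤ → ℝ) (n : ℤ × ℤ) : ℝ :=
  ‖down m (conv X (flip W)) n‖

/-- The real-part and max-pooling operator `X ↦ maxpool_q ((X * flip (Re W)) ↓ m)`. -/
def rgpool (m q : ℕ) (W : ℤ × ℤ → ℂ) (X : ℤ × ℤ → ℝ) : ℤ × ℤ → ℝ :=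
  maxpool q (down m (conv X (flip fun n => (W n).re)))

/-! ### Interpolation with sampling interval `s` -/

/-- The normalized two-dimensional sinc function, whose Fourier transform is `s` times the
indicator function of `[-π/s, π/s]²`. -/
def sincKernel (s : ℝ) (x : ℝ × ℝ) : ℝ :=
  (1 / s) * (Real.sinc (Real.pi * x.1 / s) * Real.sinc (Real.pi * x.2 / s))

/-- Shannon interpolation `x ↦ ∑ₙ X[n] φ(x - s n)` of a sequence. -/
def interp {E : Type*} [NormedAddCommGroup E] [NormedSpace ℝ E]
    (s : ℝ) (X : ℤ × ℤ → E) (x : ℝ × ℝ) : E :=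
  ∑' n, sincKernel s (x - s • toReal n) • X n

/-- Translation of a sequence by a real vector: `(T_u X)[n] = s f(s n - s u)`, with `f` the
interpolation of `X`. -/
def shift (s : ℝ) (u : ℝ × ℝ) (X : ℤ × ℤ → ℝ) (n : ℤ × ℤ) : ℝ :=
  s * interp s X (s • toReal n - s • u)

/-- The function `f * ψ̄`, with `f` and `ψ` the interpolations of `X` and `W` and
`ψ̄(x) = ψ(-x)`. -/
def contConv (s : ℝ) (W : ℤ × ℤ → ℂ) (X : ℤ × ℤ → ℝ) : ℝ × ℝ → ℂ :=
  interp s X ⋆[ContinuousLinearMap.lsmul ℝ ℝ, volume] flip (interp s W)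

/-- The modulus of `f * ψ̄`. -/
def modulus (s : ℝ) (W : ℤ × ℤ → ℂ) (X : ℤ × ℤ → ℝ) (x : ℝ × ℝ) : ℝ := ‖contConv s W X x‖

/-- The phase of `f * ψ̄`. -/
def phase (s : ℝ) (W : ℤ × ℤ → ℂ) (X : ℤ × ℤ → ℝ) (x : ℝ × ℝ) : ℝ := angle (contConv s W X x)

/-- The unit complex number with the phase of `f * ψ̄`. -/
def unitPhase (s : ℝ) (W : ℤ × ℤ → ℂ) (X : ℤ × ℤ → ℝ) (x : ℝ × ℝ) : ℂ :=
  Complex.exp (Complex.I * (phase s W X x : ℂ))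

/-- `g_X(x, h) = cos(⟨ν, h⟩ - η_X(x))` with `ν = ξ / s` and `η_X` the phase. -/
def gFun (s : ℝ) (ξ : ℝ × ℝ) (W : ℤ × ℤ → ℂ) (X : ℤ × ℤ → ℝ) (x h : ℝ × ℝ) : ℝ :=
  Real.cos (dot (s⁻¹ • ξ) h - phase s W X x)

/-- `(δX)[n] = (C_{2m} X)[n] (1 - max_k g_X(x_n, h_k))` with `x_n = 2 m s n`, `h_k = m s k`. -/
def deltaOp (s : ℝ) (ξ : ℝ × ℝ) (m q : ℕ) (W : ℤ × ℤ → ℂ) (X : ℤ × ℤ → ℝ) (n : ℤ × ℤ) : ℝ :=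
  cgmod (2 * m) W X n *
    (1 - gridMax q fun k =>
      gFun s ξ W X ((2 * m * s) • toReal n) ((m * s) • toReal k))

/-! ### The bound -/

/-- The arguments of the numbers `exp(i⟨ζ, k⟩)`, for `k` in the grid `{-q, …, q}²`, in ascending
order and counted with multiplicity. -/
def gridAngles (q : ℕ) (ζ : ℝ × ℝ) : List ℝ :=
  ((grid q).val.map fun k => angle (Complex.exp (Complex.I * (dot ζ (toReal k) : ℂ)))).sort

/-- The gap `θ_{i+1} - θ_i` between consecutive arguments, the one after the last being `2π`. -/
def gap (q : ℕ) (ζ : ℝ × ℝ) (i : ℕ) : ℝ :=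
  (gridAngles q ζ).getD (i + 1) (2 * Real.pi) - (gridAngles q ζ).getD i (2 * Real.pi)

/-- The function `γ_q`. -/
def gammaFun (q : ℕ) (ζ : ℝ × ℝ) : ℝ :=
  Real.sqrt (3 / 2 + 1 / (4 * Real.pi) *
    ∑ i ∈ Finset.range ((2 * q + 1) ^ 2), (Real.sin (gap q ζ i) - 8 * Real.sin (gap q ζ i / 2)))

/-- The function `α`. -/
def alphaFun (τ : ℝ × ℝ) : ℝ := normOne τ / 2

/-! ### Hypotheses -/

/-- The uniform distribution on the unit circle of `ℂ`: the law of `exp(iθ)` for `θ` uniformly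
distributed on `[0, 2π)`. -/
def uniformCircle : Measure ℂ :=
  (ProbabilityTheory.cond volume (Set.Ico (0 : ℝ) (2 * Real.pi))).map
    fun θ : ℝ => Complex.exp (Complex.I * (θ : ℂ))

/-- The phase of `F_X * ψ̄` is uniformly distributed on the circle at each point. -/
def UniformPhase {Ω : Type*} [MeasurableSpace Ω] (μ : Measure Ω) (s : ℝ) (W : ℤ × ℤ → ℂ)
    (X : Ω → ℤ × ℤ → ℝ) : Prop :=
  ∀ x : ℝ × ℝ, HasLaw (fun ω => unitPhase s W (X ω) x) uniformCircle μ

/-- The phase of `F_X * ψ̄` at any point is independent of the random vector of the moduli of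
`F_X * ψ̄` at any finite number of points. -/
def PhaseIndepModulus {Ω : Type*} [MeasurableSpace Ω] (μ : Measure Ω) (s : ℝ) (W : ℤ × ℤ → ℂ)
    (X : Ω → ℤ × ℤ → ℝ) : Prop :=
  ∀ n : ℕ, 1 ≤ n → ∀ (x : ℝ × ℝ) (y : Fin n → ℝ × ℝ),
    IndepFun (fun ω i => modulus s W (X ω) (y i)) (fun ω => unitPhase s W (X ω) x) μ

/-- The conjectured comparison of the modulus and max-pooling operators for the filter `W`, with
function `β`: `β` maps `ℝ₊` to `ℝ₊`, `β(t) = O(t)` as `t → 0`, and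
`‖C_{2m} X - R_{m,q} X‖₂ ≤ (1 + β(mκ)) ‖δX‖₂` for every real square-summable `X`. -/
def ModPoolComparison (s : ℝ) (ξ : ℝ × ℝ) (κ : ℝ) (m q : ℕ) (W : ℤ × ℤ → ℂ) (β : ℝ → ℝ) : Prop :=
  (∀ t, 0 ≤ t → 0 ≤ β t) ∧ β =O[𝓝[>] 0] (fun t => t) ∧
    ∀ X : ℤ × ℤ → ℝ, Memℓp X 2 →
      l2norm (cgmod (2 * m) W X - rgpool m q W X) ≤
        ENNReal.ofReal (1 + β (m * κ)) * l2norm (deltaOp s ξ m q W X)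

/-- The random variable `‖R_{m,q}(T_u X) - R_{m,q} X‖₂ / ‖C_{2m} X‖₂`. -/
def discrepancy (s : ℝ) (m q : ℕ) (W : ℤ × ℤ → ℂ) (u : ℝ × ℝ) (X : ℤ × ℤ → ℝ) : ℝ≥0∞ :=
  l2norm (rgpool m q W (shift s u X) - rgpool m q W X) / l2norm (cgmod (2 * m) W X)

end GaborPool

end

noncomputable section

namespace GaborPool

/-! Insert `C_{2m}(T_u X)` and `C_{2m} X` between the two max-pooling outputs. By the assumed
comparison, the two outer differences cost `1 + β` times a defect norm each. The middle difference
concerns moduli only and is deterministic.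

Deterministic part. `X` is the sequence of Fourier coefficients (`coef`) of some `G` in `L²([-π,
π]²)`. Translation multiplies `G` by a character, and both the discrete and the continuous
convolution with the flipped filter are `coef` of `G * What` (`conv_eq_coef`, `contConv_eq_coef`).
This product lives in a square of side `κ ≤ 2π / (2m)`, so the samples on the grid of step `2m` obey
Parseval without aliasing (`tsum_enorm_coef_subsample_sq`). Hence the norm of `C_{2m}` is invariant
under translation. Up to the constant phase at `ξ`, translation by `u` multiplies by `exp(i⟨ω - ξ,
u⟩)`, which is within `‖κu‖₁ / 2` of `1`.

Probabilistic part. The defect at `n` is a modulus times a function of the phase at the same point.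
In the squared quotient, the weights `M_n² / ∑ M_k²` depend on moduli alone, so each is independent
of its own phase, and they sum to at most `1`. The expected squared quotient is therefore at most
the mean square of `phaseDefect` over the circle, and Jensen's inequality gives the root
(`lintegral_l2norm_deltaOp_shift_div_le`). That mean square is at most `γ_q²`: on each arc between
consecutive grid angles, the maximum of cosines dominates the cosine of the distance to the nearer
endpoint (`integral_phaseDefect_sq_le_gap`). -/

/-! ### Fourier series on a square -/

/-- An integrable function on an interval whose Fourier coefficients all vanish is zero. -/
theorem ae_eq_zero_of_fourier_eq_zero {a L : ℝ} (hL : 0 < L) {f : ℝ → ℂ}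
    (hf : Integrable f (volume.restrict (Set.Icc a (a + L))))
    (h : ∀ n : ℤ, ∫ x in Set.Icc a (a + L),
      f x * Complex.exp (Complex.I * ((2 * Real.pi / L * n * x : ℝ) : ℂ)) = 0) :
    f =ᵐ[volume.restrict (Set.Icc a (a + L))] 0 := by
  have : Fact (0 < L) := ⟨hL⟩
  have hbd (G : C(AddCircle L, ℂ)) :
      Integrable (fun x : ℝ => f x * G x) (volume.restrict (Set.Icc a (a + L))) :=
    hf.mul_bdd (c := ‖G‖) (by
      have : Continuous fun x : ℝ => G x := G.continuous.comp (AddCircle.continuous_mk' L)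
      exact this.aestronglyMeasurable) (ae_of_all _ fun x => G.norm_coe_le_norm _)
  -- The continuous functions on the circle orthogonal to `f` form a closed subspace containing
  -- every character; by density of trigonometric polynomials it is everything.
  let K : Submodule ℂ C(AddCircle L, ℂ) :=
    { carrier := {G | ∫ x in Set.Icc a (a + L), f x * G x = 0}
      add_mem' := by
        intro G H hG hH
        simp only [Set.mem_ofPred_eq, ContinuousMap.add_apply, mul_add] at *
        rw [integral_add (hbd G) (hbd H), hG, hH, add_zero]
      zero_mem' := by simp
      smul_mem' := by
        intro c G hG
        simp only [Set.mem_ofPred_eq, ContinuousMap.smul_apply, smul_eq_mul] at *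
        simp_rw [mul_left_comm _ c]
        rw [integral_const_mul, hG, mul_zero] }
  have hK : IsClosed (K : Set C(AddCircle L, ℂ)) := by
    have hc : Continuous fun G : C(AddCircle L, ℂ) => ∫ x in Set.Icc a (a + L), f x * G x := by
      refine continuous_iff_continuousAt.2 fun G => ?_
      refine tendsto_integral_filter_of_dominated_convergence (fun x => ‖f x‖ * (‖G‖ + 1))
        (.of_forall fun H => (hbd H).aestronglyMeasurable) ?_ (hf.norm.mul_const _) ?_
      · have : ∀ᶠ H in 𝓝 G, ‖H‖ < ‖G‖ + 1 :=
          continuous_norm.continuousAt.eventually_lt continuousAt_const (by simp)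
        filter_upwards [this] with H hH
        refine ae_of_all _ fun x => ?_
        rw [norm_mul]
        gcongr
        exact (H.norm_coe_le_norm _).trans hH.le
      · refine ae_of_all _ fun x => ?_
        exact ((continuous_eval_const (x : AddCircle L)).tendsto G).const_mul _
    exact isClosed_singleton.preimage hc
  have htop : K = ⊤ := by
    rw [eq_top_iff, ← span_fourier_closure_eq_top]
    refine Submodule.topologicalClosure_minimal _ (Submodule.span_le.2 ?_) hK
    rintro _ ⟨n, rfl⟩
    change ∫ x in Set.Icc a (a + L), f x * fourier n (x : AddCircle L) = 0
    rw [← h n]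
    refine integral_congr_ae (ae_of_all _ fun x => ?_)
    simp only [fourier_coe_apply]
    congr 2
    push_cast
    ring
  have hzero : ∀ᵐ x, x ∈ Set.Ioo a (a + L) → f x = 0 := by
    refine isOpen_Ioo.ae_eq_zero_of_integral_contDiff_smul_eq_zero ?_ ?_
    · exact (IntegrableOn.mono_set hf Set.Ioo_subset_Icc_self).locallyIntegrableOn
    · intro g hg _ hsupp
      have h0 : g a = 0 := by
        by_contra hne
        exact (lt_irrefl a) (hsupp (subset_tsupport g hne)).1
      have h1 : g (a + L) = 0 := by
        by_contra hne
        exact (lt_irrefl _) (hsupp (subset_tsupport g hne)).2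
      -- A test function supported in the open interval vanishes at both endpoints, so it descends
      -- to a continuous function on the circle.
      let G : C(AddCircle L, ℂ) := ⟨AddCircle.liftIco L a fun x => (g x : ℂ),
        AddCircle.liftIco_continuous (by simp [h0, h1])
          (Complex.continuous_ofReal.comp hg.continuous).continuousOn⟩
      have hG : ∫ x in Set.Icc a (a + L), f x * G x = 0 := by
        have : G ∈ K := htop ▸ Submodule.mem_top
        exact this
      rw [← hG, integral_Icc_eq_integral_Ico, ← integral_indicator measurableSet_Ico]
      refine integral_congr_ae (ae_of_all _ fun x => ?_)
      by_cases hx : x ∈ Set.Ico a (a + L)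
      · simp only [Set.indicator_of_mem hx, G, ContinuousMap.coe_mk,
          AddCircle.liftIco_coe_apply hx, Complex.real_smul, mul_comm]
      · have : g x = 0 := by
          by_contra hne
          exact hx (Set.Ioo_subset_Ico_self (hsupp (subset_tsupport g hne)))
        simp [Set.indicator_of_notMem hx, this]
  rw [← restrict_Ioo_eq_restrict_Icc]
  exact (ae_restrict_iff' measurableSet_Ioo).2 hzero

/-- The character `ω ↦ exp(i⟨ω, x⟩)`. -/
def chi (x ω : ℝ × ℝ) : ℂ := Complex.exp (Complex.I * (dot ω x : ℂ))

theorem chi_add (x y ω : ℝ × ℝ) : chi (x + y) ω = chi x ω * chi y ω := by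
  rw [chi, chi, chi, ← Complex.exp_add]
  congr 1
  simp only [dot, Prod.fst_add, Prod.snd_add]
  push_cast
  ring

@[simp]
theorem chi_zero (ω : ℝ × ℝ) : chi 0 ω = 1 := by simp [chi, dot]

theorem conj_chi (x ω : ℝ × ℝ) : (starRingEnd ℂ) (chi x ω) = chi (-x) ω := by
  rw [chi, chi, ← Complex.exp_conj]
  congr 1
  simp [dot]
  ring

@[simp]
theorem norm_chi (x ω : ℝ × ℝ) : ‖chi x ω‖ = 1 := by
  rw [chi, mul_comm, Complex.norm_exp_ofReal_mul_I]

theorem continuous_chi : Continuous fun p : (ℝ × ℝ) × (ℝ × ℝ) => chi p.1 p.2 := by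
  unfold chi dot
  fun_prop

theorem continuous_chi_right (x : ℝ × ℝ) : Continuous (chi x) :=
  continuous_chi.comp (by fun_prop : Continuous fun ω => (x, ω))

theorem continuous_chi_left (ω : ℝ × ℝ) : Continuous fun x => chi x ω :=
  continuous_chi.comp (by fun_prop : Continuous fun x => (x, ω))

/-- Lebesgue measure on the square of side `L` with lower left corner `a`. -/
def box (a : ℝ × ℝ) (L : ℝ) : Measure (ℝ × ℝ) :=
  volume.restrict (Set.Icc a.1 (a.1 + L) ×ˢ Set.Icc a.2 (a.2 + L))

theorem box_eq_prod (a : ℝ × ℝ) (L : ℝ) :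
    box a L = (volume.restrict (Set.Icc a.1 (a.1 + L))).prod
      (volume.restrict (Set.Icc a.2 (a.2 + L))) := by
  rw [box, Measure.prod_restrict, Measure.volume_eq_prod]

instance (a : ℝ × ℝ) (L : ℝ) : IsFiniteMeasure (box a L) := by
  rw [box_eq_prod]; infer_instance

theorem chi_eq_mul (c : ℝ) (n : ℤ × ℤ) (ω : ℝ × ℝ) :
    chi (c • toReal n) ω = Complex.exp (Complex.I * ((c * n.1 * ω.1 : ℝ) : ℂ)) *
      Complex.exp (Complex.I * ((c * n.2 * ω.2 : ℝ) : ℂ)) := by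
  rw [chi, ← Complex.exp_add]
  congr 1
  simp [dot, toReal]
  ring

theorem integrable_mul_chi {ν : Measure (ℝ × ℝ)} {G : ℝ × ℝ → ℂ} (hG : Integrable G ν)
    (x : ℝ × ℝ) : Integrable (fun ω => G ω * chi x ω) ν :=
  hG.mul_bdd (c := 1) (continuous_chi_right x).aestronglyMeasurable
    (ae_of_all _ fun ω => (norm_chi x ω).le)

theorem memLp_mul_chi {ν : Measure (ℝ × ℝ)} {p : ℝ≥0∞} {G : ℝ × ℝ → ℂ} (hG : MemLp G p ν)
    (x : ℝ × ℝ) : MemLp (fun ω => G ω * chi x ω) p ν :=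
  hG.of_le (hG.1.mul (continuous_chi_right x).aestronglyMeasurable)
    (ae_of_all _ fun ω => by simp)

theorem memLp_chi (ν : Measure (ℝ × ℝ)) [IsFiniteMeasure ν] (p : ℝ≥0∞) (x : ℝ × ℝ) :
    MemLp (chi x) p ν :=
  MemLp.of_bound (continuous_chi_right x).aestronglyMeasurable 1
    (ae_of_all _ fun ω => (norm_chi x ω).le)

/-- An integrable function on a square whose Fourier coefficients all vanish is zero. -/
theorem ae_eq_zero_of_forall_integral_chi_eq_zero {a : ℝ × ℝ} {L : ℝ} (hL : 0 < L)
    {G : ℝ × ℝ → ℂ} (hG : Integrable G (box a L))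
    (h : ∀ n : ℤ × ℤ, ∫ ω, G ω * chi ((2 * Real.pi / L) • toReal n) ω ∂box a L = 0) :
    G =ᵐ[box a L] 0 := by
  rw [box_eq_prod] at *
  set μ₁ := volume.restrict (Set.Icc a.1 (a.1 + L))
  set μ₂ := volume.restrict (Set.Icc a.2 (a.2 + L))
  let e : ℤ → ℝ → ℂ := fun n x =>
    Complex.exp (Complex.I * ((2 * Real.pi / L * n * x : ℝ) : ℂ))
  have he : ∀ n, Continuous (e n) := fun n => by fun_prop
  have hen : ∀ n x, ‖e n x‖ = 1 := fun n x => by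
    simp only [e]; rw [mul_comm, Complex.norm_exp_ofReal_mul_I]
  have hint (k : ℤ) : Integrable (fun ω : ℝ × ℝ => G ω * e k ω.2) (μ₁.prod μ₂) :=
    hG.mul_bdd (c := 1) ((he k).comp continuous_snd).aestronglyMeasurable
      (ae_of_all _ fun ω => (hen _ _).le)
  -- Fubini: for fixed `k`, the partial coefficient in `y` is a function of `x` with all
  -- coefficients zero. Only countably many `k` occur, so almost every slice then has all its
  -- coefficients zero.
  have h1 (k : ℤ) : (fun x => ∫ y, G (x, y) * e k y ∂μ₂) =ᵐ[μ₁] 0 := by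
    refine ae_eq_zero_of_fourier_eq_zero hL (hint k).integral_prod_left fun n => ?_
    rw [← h (n, k), integral_prod _ (integrable_mul_chi hG _)]
    refine integral_congr_ae (ae_of_all _ fun x => ?_)
    simp only [← integral_mul_const]
    refine integral_congr_ae (ae_of_all _ fun y => ?_)
    simp only [chi_eq_mul, e]
    ring
  have h2 : ∀ᵐ x ∂μ₁, (fun y => G (x, y)) =ᵐ[μ₂] 0 := by
    filter_upwards [ae_all_iff.2 h1, hG.prod_right_ae] with x hx hxi
    exact ae_eq_zero_of_fourier_eq_zero hL hxi hx
  have h3 : ∫⁻ ω, ‖G ω‖ₑ ∂(μ₁.prod μ₂) = 0 := by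
    rw [lintegral_prod _ hG.1.enorm, lintegral_eq_zero_of_ae_eq_zero]
    filter_upwards [h2] with x hx
    refine lintegral_eq_zero_of_ae_eq_zero ?_
    filter_upwards [hx] with y hy
    simp [hy]
  rw [lintegral_eq_zero_iff' hG.1.enorm] at h3
  filter_upwards [h3] with ω hω
  simpa using hω

/-! ### Orthonormality and completeness of the characters of a square -/

theorem integral_exp_interval {a L : ℝ} (hL : 0 < L) (n : ℤ) :
    ∫ x in Set.Icc a (a + L), Complex.exp (Complex.I * ((2 * Real.pi / L * n * x : ℝ) : ℂ)) =
      if n = 0 then (L : ℂ) else 0 := by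
  rw [integral_Icc_eq_integral_Ioc, ← intervalIntegral.integral_of_le (by linarith)]
  split_ifs with hn
  · simp [hn]
  · have hc : Complex.I * ((2 * Real.pi / L * n : ℝ) : ℂ) ≠ 0 := by
      refine mul_ne_zero Complex.I_ne_zero ?_
      have := Real.pi_pos
      have : (n : ℝ) ≠ 0 := by exact_mod_cast hn
      exact_mod_cast (by positivity : 2 * Real.pi / L * n ≠ 0)
    have : ∀ x : ℝ, Complex.I * ((2 * Real.pi / L * n * x : ℝ) : ℂ) =
        Complex.I * ((2 * Real.pi / L * n : ℝ) : ℂ) * x := fun x => by push_cast; ring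
    simp_rw [this]
    rw [integral_exp_mul_complex hc]
    have h2 : Complex.I * ((2 * Real.pi / L * n : ℝ) : ℂ) * ((a + L : ℝ) : ℂ) =
        Complex.I * ((2 * Real.pi / L * n : ℝ) : ℂ) * a + n * (2 * Real.pi * Complex.I) := by
      have : (L : ℂ) ≠ 0 := by exact_mod_cast hL.ne'
      push_cast
      field_simp
    rw [h2, Complex.exp_add, Complex.exp_int_mul_two_pi_mul_I]
    simp

theorem integral_chi_box {a : ℝ × ℝ} {L : ℝ} (hL : 0 < L) (n : ℤ × ℤ) :
    ∫ ω, chi ((2 * Real.pi / L) • toReal n) ω ∂box a L = if n = 0 then (L : ℂ) ^ 2 else 0 := by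
  simp_rw [box_eq_prod, chi_eq_mul]
  rw [integral_prod_mul
    (fun x : ℝ => Complex.exp (Complex.I * ((2 * Real.pi / L * n.1 * x : ℝ) : ℂ)))
    (fun x : ℝ => Complex.exp (Complex.I * ((2 * Real.pi / L * n.2 * x : ℝ) : ℂ))),
    integral_exp_interval hL, integral_exp_interval hL]
  rcases n with ⟨n, k⟩
  by_cases h1 : n = 0 <;> by_cases h2 : k = 0 <;> simp [h1, h2, sq]

theorem toReal_sub (n k : ℤ × ℤ) : toReal (n - k) = toReal n - toReal k := by
  simp [toReal]

theorem toReal_neg (n : ℤ × ℤ) : toReal (-n) = -toReal n := by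
  simp [toReal]

theorem toReal_nsmul (m : ℕ) (n : ℤ × ℤ) : toReal (m • n) = (m : ℝ) • toReal n := by
  simp [toReal]

/-- The normalized character of integer frequency `n` on a square. -/
def boxVec (a : ℝ × ℝ) (L : ℝ) (n : ℤ × ℤ) : Lp ℂ 2 (box a L) :=
  (L : ℂ)⁻¹ • (memLp_chi (box a L) 2 ((2 * Real.pi / L) • toReal n)).toLp

theorem inner_boxVec {a : ℝ × ℝ} {L : ℝ} (n : ℤ × ℤ) {G : ℝ × ℝ → ℂ} (hG : MemLp G 2 (box a L)) :
    inner ℂ (boxVec a L n) hG.toLp =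
      (L : ℂ)⁻¹ * ∫ ω, G ω * chi (-((2 * Real.pi / L) • toReal n)) ω ∂box a L := by
  rw [boxVec, inner_smul_left, L2.inner_def]
  congr 1
  · simp
  · refine integral_congr_ae ?_
    filter_upwards [hG.coeFn_toLp, (memLp_chi (box a L) 2
      ((2 * Real.pi / L) • toReal n)).coeFn_toLp] with ω h1 h2
    rw [h1, h2, RCLike.inner_apply, conj_chi]

theorem orthonormal_boxVec {a : ℝ × ℝ} {L : ℝ} (hL : 0 < L) : Orthonormal ℂ (boxVec a L) := by
  rw [orthonormal_iff_ite]
  intro n k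
  have hL' : (L : ℂ) ≠ 0 := by exact_mod_cast hL.ne'
  rw [boxVec.eq_def a L k, inner_smul_right, inner_boxVec]
  have : ∀ ω, chi ((2 * Real.pi / L) • toReal k) ω * chi (-((2 * Real.pi / L) • toReal n)) ω =
      chi ((2 * Real.pi / L) • toReal (k - n)) ω := fun ω => by
    rw [← chi_add, toReal_sub, smul_sub, sub_eq_add_neg]
  simp_rw [this, integral_chi_box hL, sub_eq_zero, eq_comm (a := k)]
  split_ifs
  · field_simp
  · simp

/-- The Hilbert basis of characters of `L²` of a square. -/
def boxBasis (a : ℝ × ℝ) {L : ℝ} (hL : 0 < L) : HilbertBasis (ℤ × ℤ) ℂ (Lp ℂ 2 (box a L)) :=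
  HilbertBasis.mkOfOrthogonalEqBot (orthonormal_boxVec hL) (by
    have hL' : (L : ℂ) ≠ 0 := by exact_mod_cast hL.ne'
    rw [Submodule.eq_bot_iff]
    intro v hv
    have hv' : ∀ n, inner ℂ (boxVec a L n) v = 0 := fun n =>
      hv _ (Submodule.subset_span ⟨n, rfl⟩)
    have hm := Lp.memLp v
    have : v = hm.toLp := (Lp.toLp_coeFn v hm).symm
    rw [Lp.eq_zero_iff_ae_eq_zero]
    refine ae_eq_zero_of_forall_integral_chi_eq_zero hL (hm.integrable (by norm_num)) fun n => ?_
    have h := hv' (-n)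
    rw [this, inner_boxVec] at h
    simpa [hL', toReal_neg] using h)

theorem boxBasis_repr (a : ℝ × ℝ) {L : ℝ} (hL : 0 < L) {G : ℝ × ℝ → ℂ}
    (hG : MemLp G 2 (box a L)) (n : ℤ × ℤ) :
    (boxBasis a hL).repr hG.toLp n =
      (L : ℂ)⁻¹ * ∫ ω, G ω * chi (-((2 * Real.pi / L) • toReal n)) ω ∂box a L := by
  rw [HilbertBasis.repr_apply_apply, boxBasis, HilbertBasis.coe_mkOfOrthogonalEqBot, inner_boxVec]

/-- Polarized Parseval identity for the Fourier series on a square. -/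
theorem hasSum_integral_chi_mul_conj {a : ℝ × ℝ} {L : ℝ} (hL : 0 < L) {G H : ℝ × ℝ → ℂ}
    (hG : MemLp G 2 (box a L)) (hH : MemLp H 2 (box a L)) :
    HasSum (fun n : ℤ × ℤ =>
      (∫ ω, G ω * chi (-((2 * Real.pi / L) • toReal n)) ω ∂box a L) *
        (starRingEnd ℂ) (∫ ω, H ω * chi (-((2 * Real.pi / L) • toReal n)) ω ∂box a L))
      ((L : ℂ) ^ 2 * ∫ ω, G ω * (starRingEnd ℂ) (H ω) ∂box a L) := by
  have hL' : (L : ℂ) ≠ 0 := by exact_mod_cast hL.ne'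
  have h := (lp.hasSum_inner ((boxBasis a hL).repr hH.toLp)
    ((boxBasis a hL).repr hG.toLp)).mul_left ((L : ℂ) ^ 2)
  rw [LinearIsometryEquiv.inner_map_map, L2.inner_def] at h
  have h1 : ∫ ω, G ω * (starRingEnd ℂ) (H ω) ∂box a L =
      ∫ ω, inner ℂ (hH.toLp H ω) (hG.toLp G ω) ∂box a L := by
    refine integral_congr_ae ?_
    filter_upwards [hG.coeFn_toLp, hH.coeFn_toLp] with ω h1 h2
    rw [h1, h2, RCLike.inner_apply]
  rw [h1]
  refine h.congr_fun fun n => ?_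
  rw [boxBasis_repr, boxBasis_repr, RCLike.inner_apply, map_mul, map_inv₀, Complex.conj_ofReal]
  field_simp

/-- Riesz–Fischer theorem on a square. -/
theorem exists_integral_chi_eq (a : ℝ × ℝ) {L : ℝ} (hL : 0 < L) {c : ℤ × ℤ → ℂ}
    (hc : Memℓp c 2) : ∃ G : ℝ × ℝ → ℂ, MemLp G 2 (box a L) ∧
      ∀ n, ∫ ω, G ω * chi (-((2 * Real.pi / L) • toReal n)) ω ∂box a L = c n := by
  have hL' : (L : ℂ) ≠ 0 := by exact_mod_cast hL.ne'
  let v := (boxBasis a hL).repr.symm ((L : ℂ)⁻¹ • (⟨c, hc⟩ : lp (fun _ : ℤ × ℤ => ℂ) 2))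
  refine ⟨v, Lp.memLp v, fun n => ?_⟩
  have h := boxBasis_repr a hL (Lp.memLp v) n
  rw [Lp.toLp_coeFn v (Lp.memLp v), LinearIsometryEquiv.apply_symm_apply] at h
  simp only [lp.coeFn_smul, Pi.smul_apply, smul_eq_mul] at h
  exact (mul_left_cancel₀ (inv_ne_zero hL') h).symm

theorem memℓp_integral_chi {a : ℝ × ℝ} {L : ℝ} (hL : 0 < L) {G : ℝ × ℝ → ℂ}
    (hG : MemLp G 2 (box a L)) :
    Memℓp (fun n : ℤ × ℤ => ∫ ω, G ω * chi (-((2 * Real.pi / L) • toReal n)) ω ∂box a L) 2 := by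
  have hL' : (L : ℂ) ≠ 0 := by exact_mod_cast hL.ne'
  have h := (lp.memℓp ((boxBasis a hL).repr hG.toLp)).const_smul (L : ℂ)
  have h1 : (L : ℂ) • ((boxBasis a hL).repr hG.toLp : ℤ × ℤ → ℂ) = fun n : ℤ × ℤ =>
      ∫ ω, G ω * chi (-((2 * Real.pi / L) • toReal n)) ω ∂box a L := by
    funext n
    rw [Pi.smul_apply, boxBasis_repr, smul_eq_mul, mul_inv_cancel_left₀ hL']
  rwa [← h1]

/-- Parseval's identity for integrable functions on a square; both sides may be infinite. -/
theorem tsum_enorm_integral_chi_sq {a : ℝ × ℝ} {L : ℝ} (hL : 0 < L) {G : ℝ × ℝ → ℂ}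
    (hG : Integrable G (box a L)) :
    ∑' n : ℤ × ℤ, ‖∫ ω, G ω * chi (-((2 * Real.pi / L) • toReal n)) ω ∂box a L‖ₑ ^ 2 =
      ENNReal.ofReal (L ^ 2) * ∫⁻ ω, ‖G ω‖ₑ ^ 2 ∂box a L := by
  set c : ℤ × ℤ → ℂ := fun n =>
    ∫ ω, G ω * chi (-((2 * Real.pi / L) • toReal n)) ω ∂box a L with hcdef
  have hsq (z : ℂ) : ‖z‖ₑ ^ 2 = ENNReal.ofReal (‖z‖ ^ 2) := by
    rw [← ofReal_norm, ENNReal.ofReal_pow (norm_nonneg _)]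
  by_cases hm : MemLp G 2 (box a L)
  · have h := hasSum_integral_chi_mul_conj hL hm hm
    simp_rw [Complex.mul_conj, Complex.normSq_eq_norm_sq] at h
    rw [integral_complex_ofReal, ← Complex.ofReal_pow, ← Complex.ofReal_mul,
      Complex.hasSum_ofReal] at h
    simp_rw [hsq]
    rw [← ENNReal.ofReal_tsum_of_nonneg (fun _ => sq_nonneg _) h.summable, h.tsum_eq,
      ENNReal.ofReal_mul (by positivity),
      ofReal_integral_eq_lintegral_ofReal hm.norm.integrable_sq (ae_of_all _ fun _ => sq_nonneg _)]
  · have hinf : ∫⁻ ω, ‖G ω‖ₑ ^ 2 ∂box a L = ⊤ := by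
      by_contra hne
      refine hm ⟨hG.1, ?_⟩
      rw [eLpNorm_lt_top_iff_lintegral_rpow_enorm_lt_top (by norm_num) (by norm_num)]
      simpa using lt_top_iff_ne_top.2 hne
    rw [hinf, ENNReal.mul_top (by simpa using hL.ne')]
    by_contra hne
    -- If the coefficients were square-summable, Riesz–Fischer would give an `L²` function with the
    -- same coefficients, equal to `G` by uniqueness, against `G ∉ L²`.
    have hc : Memℓp c 2 := by
      refine memℓp_gen ?_
      simp_rw [hsq] at hne
      simpa using (ENNReal.summable_toReal hne).congr fun n =>
        ENNReal.toReal_ofReal (sq_nonneg ‖c n‖)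
    obtain ⟨H, hH, hHc⟩ := exists_integral_chi_eq a hL hc
    have hHi := hH.integrable (by norm_num : (1 : ℝ≥0∞) ≤ 2)
    have h0 : (fun ω => G ω - H ω) =ᵐ[box a L] 0 := by
      refine ae_eq_zero_of_forall_integral_chi_eq_zero hL (hG.sub hHi) fun n => ?_
      simp_rw [sub_mul]
      rw [integral_sub (integrable_mul_chi hG _) (integrable_mul_chi hHi _), sub_eq_zero]
      have := hHc (-n)
      simp only [hcdef, toReal_neg, smul_neg, neg_neg] at this
      exact this.symm
    refine hm (hH.ae_eq ?_)
    filter_upwards [h0] with ω hω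
    exact (sub_eq_zero.1 hω).symm

/-! ### Fourier coefficients at real frequencies -/

theorem freqMeasure_eq_box : freqMeasure = box (-Real.pi, -Real.pi) (2 * Real.pi) := by
  have : -Real.pi + 2 * Real.pi = Real.pi := by ring
  simp [freqMeasure, box, this]

instance : IsFiniteMeasure freqMeasure := by
  rw [freqMeasure_eq_box]; infer_instance

/-- The Fourier coefficient at a real frequency `x` of a function on `[-π, π]²`. -/
def coef (G : ℝ × ℝ → ℂ) (x : ℝ × ℝ) : ℂ :=
  ((2 * Real.pi : ℂ) ^ 2)⁻¹ * ∫ ω, G ω * chi (-x) ω ∂freqMeasure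

/-- The reason for evaluating coefficients at real points: translation by a real vector becomes
multiplication by a character. -/
theorem coef_mul_chi (G : ℝ × ℝ → ℂ) (y x : ℝ × ℝ) :
    coef (fun ω => G ω * chi y ω) x = coef G (x - y) := by
  simp only [coef, mul_assoc, ← chi_add]
  congr 4
  ext1 ω
  congr 2
  abel

theorem coef_conj (G : ℝ × ℝ → ℂ) (x : ℝ × ℝ) :
    coef (fun ω => (starRingEnd ℂ) (G ω)) x = (starRingEnd ℂ) (coef G (-x)) := by
  simp only [coef, map_mul, ← integral_conj, conj_chi, neg_neg]
  simp [Complex.conj_ofNat]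

theorem continuous_coef {G : ℝ × ℝ → ℂ} (hG : Integrable G freqMeasure) :
    Continuous (coef G) := by
  refine continuous_const.mul ?_
  refine continuous_of_dominated (bound := fun ω => ‖G ω‖)
    (fun x => (integrable_mul_chi hG _).aestronglyMeasurable)
    (fun x => ae_of_all _ fun ω => by simp) hG.norm (ae_of_all _ fun ω => ?_)
  exact continuous_const.mul ((continuous_chi_left ω).comp continuous_neg)

theorem two_pi_div_two_pi_smul (x : ℝ × ℝ) : (2 * Real.pi / (2 * Real.pi)) • x = x := by
  rw [div_self Real.two_pi_pos.ne', one_smul]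

theorem two_pi_sq_ne_zero : ((2 * Real.pi : ℂ) ^ 2) ≠ 0 := by
  simp [Real.pi_ne_zero]

/-- Parseval's identity in polarized form. -/
theorem hasSum_coef_mul_conj {G H : ℝ × ℝ → ℂ} (hG : MemLp G 2 freqMeasure)
    (hH : MemLp H 2 freqMeasure) :
    HasSum (fun n : ℤ × ℤ => coef G (toReal n) * (starRingEnd ℂ) (coef H (toReal n)))
      (coef (fun ω => G ω * (starRingEnd ℂ) (H ω)) 0) := by
  simp only [coef]
  rw [freqMeasure_eq_box] at *
  have h := (hasSum_integral_chi_mul_conj Real.two_pi_pos hG hH).mul_left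
    (((2 * Real.pi : ℂ) ^ 2)⁻¹ * ((2 * Real.pi : ℂ) ^ 2)⁻¹)
  simp only [two_pi_div_two_pi_smul] at h
  have hne := two_pi_sq_ne_zero
  have e : ((2 * Real.pi : ℂ) ^ 2)⁻¹ * ((2 * Real.pi : ℂ) ^ 2)⁻¹ *
      (((2 * Real.pi : ℝ) : ℂ) ^ 2 * ∫ ω, G ω * (starRingEnd ℂ) (H ω)
        ∂box (-Real.pi, -Real.pi) (2 * Real.pi)) =
      ((2 * Real.pi : ℂ) ^ 2)⁻¹ * ∫ ω, G ω * (starRingEnd ℂ) (H ω) * chi (-0) ω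
        ∂box (-Real.pi, -Real.pi) (2 * Real.pi) := by
    simp only [neg_zero, chi_zero, mul_one]
    push_cast
    field_simp
  rw [e] at h
  refine h.congr_fun fun n => ?_
  simp only [map_mul, map_inv₀, map_pow, map_ofNat, Complex.conj_ofReal]
  ring

theorem exists_coef_eq {c : ℤ × ℤ → ℂ} (hc : Memℓp c 2) :
    ∃ G : ℝ × ℝ → ℂ, MemLp G 2 freqMeasure ∧ ∀ n, coef G (toReal n) = c n := by
  obtain ⟨G, hG, h⟩ := exists_integral_chi_eq (-Real.pi, -Real.pi) Real.two_pi_pos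
    (hc.const_smul ((2 * Real.pi : ℂ) ^ 2))
  simp only [two_pi_div_two_pi_smul] at h
  refine ⟨G, freqMeasure_eq_box ▸ hG, fun n => ?_⟩
  rw [coef, freqMeasure_eq_box, h, Pi.smul_apply, smul_eq_mul,
    inv_mul_cancel_left₀ two_pi_sq_ne_zero]

theorem memℓp_coef {G : ℝ × ℝ → ℂ} (hG : MemLp G 2 freqMeasure) :
    Memℓp (fun n : ℤ × ℤ => coef G (toReal n)) 2 := by
  rw [freqMeasure_eq_box] at hG
  have h := (memℓp_integral_chi Real.two_pi_pos hG).const_smul ((2 * Real.pi : ℂ) ^ 2)⁻¹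
  simp only [two_pi_div_two_pi_smul] at h
  rw [← freqMeasure_eq_box] at h
  exact h

/-- The square-summable samples of a Fourier transform at a translated integer grid have the same
energy as the function. -/
theorem tsum_enorm_coef_sq {G : ℝ × ℝ → ℂ} (hG : Integrable G freqMeasure) (x : ℝ × ℝ) :
    ∑' n : ℤ × ℤ, ‖coef G (x + toReal n)‖ₑ ^ 2 =
      ‖((2 * Real.pi : ℂ) ^ 2)⁻¹‖ₑ ^ 2 * (ENNReal.ofReal ((2 * Real.pi) ^ 2) *
        ∫⁻ ω, ‖G ω‖ₑ ^ 2 ∂freqMeasure) := by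
  have h1 : ∀ n : ℤ × ℤ, coef G (x + toReal n) = coef (fun ω => G ω * chi (-x) ω) (toReal n) :=
    fun n => by rw [coef_mul_chi]; congr 1; abel
  have hG' := integrable_mul_chi hG (-x)
  simp_rw [h1, coef, enorm_mul, mul_pow, ENNReal.tsum_mul_left]
  rw [freqMeasure_eq_box] at *
  have h := tsum_enorm_integral_chi_sq Real.two_pi_pos hG'
  simp only [two_pi_div_two_pi_smul] at h
  rw [h, mul_pow]
  congr 2
  refine lintegral_congr fun ω => ?_
  rw [enorm_mul, ← ofReal_norm (chi _ _), norm_chi, ENNReal.ofReal_one, mul_one]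

/-! ### Shannon interpolation -/

theorem integral_exp_Icc_pi (t : ℝ) :
    ∫ x in Set.Icc (-Real.pi) Real.pi, Complex.exp (Complex.I * ((x * t : ℝ) : ℂ)) =
      2 * Real.pi * (Real.sinc (Real.pi * t) : ℂ) := by
  rw [integral_Icc_eq_integral_Ioc,
    ← intervalIntegral.integral_of_le (by linarith [Real.pi_pos])]
  rcases eq_or_ne t 0 with rfl | ht
  · simp
    ring
  · have hc : Complex.I * (t : ℂ) ≠ 0 := mul_ne_zero Complex.I_ne_zero (by exact_mod_cast ht)
    have : ∀ x : ℝ, Complex.I * ((x * t : ℝ) : ℂ) = Complex.I * (t : ℂ) * x := fun x => by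
      push_cast; ring
    simp_rw [this]
    rw [integral_exp_mul_complex hc, Real.sinc_of_ne_zero (mul_ne_zero Real.pi_ne_zero ht)]
    push_cast
    rw [Complex.sin]
    have hpi : (Real.pi : ℂ) ≠ 0 := by exact_mod_cast Real.pi_ne_zero
    have ht' : (t : ℂ) ≠ 0 := by exact_mod_cast ht
    have e1 : Complex.I * (t : ℂ) * Real.pi = Real.pi * t * Complex.I := by ring
    have e2 : Complex.I * (t : ℂ) * -Real.pi = -(Real.pi * t) * Complex.I := by ring
    rw [e1, e2]
    field_simp
    rw [Complex.I_sq]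
    ring

theorem coef_chi (x y : ℝ × ℝ) :
    coef (chi x) y = ((Real.sinc (Real.pi * (x.1 - y.1)) * Real.sinc (Real.pi * (x.2 - y.2)) : ℝ) : ℂ)
    := by
  have : ∀ ω : ℝ × ℝ, chi x ω * chi (-y) ω =
      Complex.exp (Complex.I * ((ω.1 * (x.1 - y.1) : ℝ) : ℂ)) *
        Complex.exp (Complex.I * ((ω.2 * (x.2 - y.2) : ℝ) : ℂ)) := fun ω => by
    rw [← chi_add, chi, ← Complex.exp_add]
    congr 1
    simp [dot]
    ring
  simp_rw [coef, this, freqMeasure]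
  rw [Measure.volume_eq_prod, ← Measure.prod_restrict,
    integral_prod_mul (fun t : ℝ => Complex.exp (Complex.I * ((t * (x.1 - y.1) : ℝ) : ℂ)))
      (fun t : ℝ => Complex.exp (Complex.I * ((t * (x.2 - y.2) : ℝ) : ℂ))),
    integral_exp_Icc_pi, integral_exp_Icc_pi]
  have hpi : (Real.pi : ℂ) ≠ 0 := by exact_mod_cast Real.pi_ne_zero
  push_cast
  field_simp

theorem mul_sincKernel {s : ℝ} (hs : 0 < s) (x : ℝ × ℝ) :
    s * sincKernel s (s • x) = Real.sinc (Real.pi * x.1) * Real.sinc (Real.pi * x.2) := by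
  have h : ∀ t : ℝ, Real.pi * (s * t) / s = Real.pi * t := fun t => by field_simp
  simp only [sincKernel, Prod.smul_fst, Prod.smul_snd, smul_eq_mul, h]
  field_simp

/-- Parseval for `G` against the character `chi x`, whose integer coefficients are the sinc values
of the kernel (`coef_chi`). This is Shannon's formula. -/
theorem hasSum_interp {s : ℝ} (hs : 0 < s) {G : ℝ × ℝ → ℂ} (hG : MemLp G 2 freqMeasure)
    (x : ℝ × ℝ) :
    HasSum (fun n : ℤ × ℤ => sincKernel s (s • x - s • toReal n) • coef G (toReal n))
      ((s : ℂ)⁻¹ * coef G x) := by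
  have h := (hasSum_coef_mul_conj hG (memLp_chi freqMeasure 2 x)).mul_left (s : ℂ)⁻¹
  simp only [conj_chi, coef_mul_chi, zero_sub, neg_neg] at h
  refine h.congr_fun fun n => ?_
  have hs' : (s : ℂ) ≠ 0 := by exact_mod_cast hs.ne'
  rw [coef_chi, Complex.conj_ofReal, ← smul_sub, Complex.real_smul,
    show Real.sinc (Real.pi * (x.1 - (toReal n).1)) * Real.sinc (Real.pi * (x.2 - (toReal n).2)) =
      s * sincKernel s (s • (x - toReal n)) from
      (mul_sincKernel hs (x - toReal n)).symm]
  push_cast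
  field_simp

theorem interp_eq_coef {s : ℝ} (hs : 0 < s) {G : ℝ × ℝ → ℂ} (hG : MemLp G 2 freqMeasure)
    {X : ℤ × ℤ → ℝ} (hX : ∀ n, coef G (toReal n) = X n) (x : ℝ × ℝ) :
    ((interp s X (s • x) : ℝ) : ℂ) = (s : ℂ)⁻¹ * coef G x := by
  rw [interp, Complex.ofReal_tsum, ← (hasSum_interp hs hG x).tsum_eq]
  refine tsum_congr fun n => ?_
  simp [hX]

theorem interp_eq_conj_coef {s : ℝ} (hs : 0 < s) {G : ℝ × ℝ → ℂ} (hG : MemLp G 2 freqMeasure)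
    {W : ℤ × ℤ → ℂ} (hW : ∀ n, coef G (toReal n) = (starRingEnd ℂ) (W n)) (x : ℝ × ℝ) :
    interp s W (s • x) = (s : ℂ)⁻¹ * (starRingEnd ℂ) (coef G x) := by
  have h := (hasSum_interp hs hG x).map (starRingEnd ℂ) Complex.continuous_conj
  rw [map_mul, map_inv₀, Complex.conj_ofReal] at h
  rw [interp, ← h.tsum_eq]
  refine tsum_congr fun n => ?_
  simp [hW]

theorem coef_eq_shift {s : ℝ} (hs : 0 < s) {G : ℝ × ℝ → ℂ} (hG : MemLp G 2 freqMeasure)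
    {X : ℤ × ℤ → ℝ} (hX : ∀ n, coef G (toReal n) = X n) (u : ℝ × ℝ) (n : ℤ × ℤ) :
    coef (fun ω => G ω * chi u ω) (toReal n) = shift s u X n := by
  have hs' : (s : ℂ) ≠ 0 := by exact_mod_cast hs.ne'
  rw [coef_mul_chi, shift, ← smul_sub, Complex.ofReal_mul, interp_eq_coef hs hG hX,
    mul_inv_cancel_left₀ hs']

/-- `coef` has the sign opposite to Fourier inversion; conjugating `What` restores it and conjugates
`W`. On a finite measure, `L²` convergence of the partial sums implies `L¹` convergence, so their
coefficients converge too. -/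
theorem coef_of_isDTFT {W : ℤ × ℤ → ℂ} {What : ℝ × ℝ → ℂ} (h : IsDTFT W What) (n : ℤ × ℤ) :
    coef (fun ω => (starRingEnd ℂ) (What ω)) (toReal n) = (starRingEnd ℂ) (W n) := by
  rw [coef_conj]
  congr 1
  let P : Finset (ℤ × ℤ) → ℝ × ℝ → ℂ := fun S ω => ∑ k ∈ S, W k * chi (-toReal k) ω
  have hP : ∀ S ω, ∑ k ∈ S, W k * Complex.exp (-(Complex.I * (dot ω (toReal k) : ℂ))) = P S ω := by
    intro S ω
    refine Finset.sum_congr rfl fun k _ => ?_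
    rw [chi]
    congr 2
    simp [dot]
    ring
  have hPm : ∀ S, MemLp (P S) 2 freqMeasure := fun S =>
    memLp_finsetSum _ fun k _ => (memLp_chi freqMeasure 2 _).const_mul _
  obtain ⟨hm, ht⟩ := h
  simp only [hP] at ht
  have hi := hm.integrable (by norm_num : (1 : ℝ≥0∞) ≤ 2)
  have hPi := fun S => (hPm S).integrable (by norm_num : (1 : ℝ≥0∞) ≤ 2)
  have h1 : Tendsto (fun S => eLpNorm (fun ω => What ω - P S ω) 1 freqMeasure) atTop (𝓝 0) := by
    have hb := ENNReal.Tendsto.mul_const (b := freqMeasure Set.univ ^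
      (1 / (1 : ℝ≥0∞).toReal - 1 / (2 : ℝ≥0∞).toReal)) ht
      (.inr (ENNReal.rpow_ne_top_of_nonneg (by norm_num) (measure_ne_top _ _)))
    rw [zero_mul] at hb
    exact tendsto_of_tendsto_of_tendsto_of_le_of_le tendsto_const_nhds hb (fun _ => zero_le)
      fun S => eLpNorm_le_eLpNorm_mul_rpow_measure_univ (by norm_num) (hm.1.sub (hPm S).1)
  have h2 : Tendsto (fun S => coef (P S) (-toReal n)) atTop (𝓝 (coef What (-toReal n))) := by
    refine Tendsto.const_mul _ ?_
    refine tendsto_integral_of_L1' _ (integrable_mul_chi hi _).1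
      (.of_forall fun S => integrable_mul_chi (hPi S) _) ?_
    refine h1.congr fun S => ?_
    refine eLpNorm_congr_norm_ae (ae_of_all _ fun ω => ?_)
    rw [Pi.sub_apply, ← sub_mul, norm_mul, norm_chi, mul_one, norm_sub_rev]
  refine tendsto_nhds_unique h2 (tendsto_const_nhds.congr' ?_)
  -- As soon as `S` contains `n`, orthogonality of characters makes the coefficient of the partial
  -- sum equal to `W n`.
  filter_upwards [eventually_ge_atTop {n}] with S hS
  have hn : n ∈ S := hS (Finset.mem_singleton_self n)
  simp only [coef, P, Finset.sum_mul]
  rw [integral_finsetSum _ fun k _ => integrable_mul_chi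
    (((memLp_chi freqMeasure 1 _).integrable le_rfl).const_mul _) _]
  have hk : ∀ k : ℤ × ℤ, ∫ ω, W k * chi (-toReal k) ω * chi (- -toReal n) ω ∂freqMeasure =
      W k * if k = n then (2 * Real.pi : ℂ) ^ 2 else 0 := by
    intro k
    have := integral_chi_box (a := (-Real.pi, -Real.pi)) Real.two_pi_pos (n - k)
    simp only [two_pi_div_two_pi_smul, ← freqMeasure_eq_box, sub_eq_zero] at this
    simp_rw [mul_assoc, ← chi_add, integral_const_mul]
    rw [show -toReal k + - -toReal n = toReal (n - k) by rw [toReal_sub]; abel, this]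
    simp [eq_comm]
  simp_rw [hk]
  simp [hn]
  field_simp

/-- The cross-correlation of two square-summable sequences in terms of their transforms. -/
theorem hasSum_conv {G What : ℝ × ℝ → ℂ} (hG : MemLp G 2 freqMeasure) {X : ℤ × ℤ → ℝ}
    (hX : ∀ n, coef G (toReal n) = X n) {W : ℤ × ℤ → ℂ} (hW : IsDTFT W What) (j : ℤ × ℤ) :
    HasSum (fun k => X k • flip W (j - k)) (coef (fun ω => G ω * What ω) (toReal j)) := by
  -- This function has coefficients `conj (W (k - j))`, so Parseval against it produces the
  -- correlation at `j`.
  have hV : MemLp (fun ω => (starRingEnd ℂ) (What ω) * chi (toReal j) ω) 2 freqMeasure :=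
    memLp_mul_chi hW.1.star _
  have h := hasSum_coef_mul_conj hG hV
  simp only [coef_mul_chi, map_mul, Complex.conj_conj, conj_chi, ← mul_assoc, zero_sub, neg_neg]
    at h
  refine h.congr_fun fun k => ?_
  rw [← toReal_sub, coef_of_isDTFT hW, Complex.conj_conj, hX, flip, Complex.real_smul, neg_sub]

theorem conv_eq_coef {G What : ℝ × ℝ → ℂ} (hG : MemLp G 2 freqMeasure) {X : ℤ × ℤ → ℝ}
    (hX : ∀ n, coef G (toReal n) = X n) {W : ℤ × ℤ → ℂ} (hW : IsDTFT W What) (j : ℤ × ℤ) :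
    conv X (flip W) j = coef (fun ω => G ω * What ω) (toReal j) :=
  (hasSum_conv hG hX hW j).tsum_eq

/-! ### Plancherel identity on the plane -/

/-- The unit cell of the plane with lower left corner `n`. -/
def tile (n : ℤ × ℤ) : Set (ℝ × ℝ) := {t | (⌊t.1⌋, ⌊t.2⌋) = n}

theorem measurableSet_tile (n : ℤ × ℤ) : MeasurableSet (tile n) := by
  have : Measurable fun t : ℝ × ℝ => ((⌊t.1⌋, ⌊t.2⌋) : ℤ × ℤ) := by fun_prop
  exact this (measurableSet_singleton n)

theorem volume_tile_zero : volume (tile 0) = 1 := by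
  have : tile 0 = Set.Ico (0 : ℝ) 1 ×ˢ Set.Ico (0 : ℝ) 1 := by
    ext t
    simp [tile, Int.floor_eq_iff, Prod.ext_iff]
  rw [this, Measure.volume_eq_prod, Measure.prod_prod]
  simp

/-- Turns an integral over the plane into an integral over one cell of sums over translated integer
grids, where Parseval applies. -/
theorem volume_eq_sum_tile : (volume : Measure (ℝ × ℝ)) =
    Measure.sum fun n : ℤ × ℤ => (volume.restrict (tile 0)).map fun t => t + toReal n := by
  have hU : (⋃ n, tile n) = Set.univ := by
    ext t
    simp [tile]
  have hd : Pairwise (Function.onFun Disjoint tile) := by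
    intro n k hnk
    rw [Function.onFun, Set.disjoint_left]
    intro t h1 h2
    exact hnk (h1.symm.trans h2)
  conv_lhs => rw [← Measure.restrict_univ (μ := volume), ← hU,
    Measure.restrict_iUnion hd measurableSet_tile]
  congr 1
  ext1 n
  have hp : MeasurePreserving (fun t : ℝ × ℝ => t + toReal n) volume volume :=
    measurePreserving_add_right volume (toReal n)
  have := hp.restrict_preimage (measurableSet_tile n)
  rw [← this.map_eq]
  congr 2
  ext t
  simp [tile, toReal, Prod.ext_iff]

/-- The samples on the grid `t + ℤ²` are the integer coefficients of `G` and `H` multiplied by the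
same character, which cancels in the product. Parseval thus gives a sum independent of `t`, to be
integrated over a cell of area `1`. -/
theorem integral_coef_mul_conj {G H : ℝ × ℝ → ℂ} (hG : MemLp G 2 freqMeasure)
    (hH : MemLp H 2 freqMeasure) :
    ∫ t, coef G t * (starRingEnd ℂ) (coef H t) =
      coef (fun ω => G ω * (starRingEnd ℂ) (H ω)) 0 := by
  have hGi := hG.integrable (by norm_num : (1 : ℝ≥0∞) ≤ 2)
  have hHi := hH.integrable (by norm_num : (1 : ℝ≥0∞) ≤ 2)
  set f : ℝ × ℝ → ℂ := fun t => coef G t * (starRingEnd ℂ) (coef H t) with hf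
  have hfc : Continuous f :=
    (continuous_coef hGi).mul (Complex.continuous_conj.comp (continuous_coef hHi))
  have htr : ∀ n : ℤ × ℤ, Measurable fun t : ℝ × ℝ => t + toReal n := fun n => by fun_prop
  have hfm : ∀ n : ℤ × ℤ, Measurable fun t : ℝ × ℝ => f (t + toReal n) := fun n =>
    hfc.measurable.comp (htr n)
  have hsum : ∀ t, HasSum (fun n => f (t + toReal n))
      (coef (fun ω => G ω * (starRingEnd ℂ) (H ω)) 0) := by
    intro t
    have h := hasSum_coef_mul_conj (memLp_mul_chi hG (-t)) (memLp_mul_chi hH (-t))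
    have e : (fun ω => G ω * chi (-t) ω * (starRingEnd ℂ) (H ω * chi (-t) ω)) =
        fun ω => G ω * (starRingEnd ℂ) (H ω) := by
      ext1 ω
      have : chi (-t) ω * (starRingEnd ℂ) (chi (-t) ω) = 1 := by
        rw [conj_chi, ← chi_add]; simp
      rw [map_mul, ← mul_one (G ω * (starRingEnd ℂ) (H ω)), ← this]
      ring
    rw [e] at h
    refine h.congr_fun fun n => ?_
    simp only [hf, coef_mul_chi, sub_neg_eq_add, add_comm]
  have hfin : ∀ {K : ℝ × ℝ → ℂ}, MemLp K 2 freqMeasure → ∫⁻ ω, ‖K ω‖ₑ ^ 2 ∂freqMeasure ≠ ⊤ := by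
    intro K hK
    have := (eLpNorm_lt_top_iff_lintegral_rpow_enorm_lt_top (by norm_num) (by norm_num)).1 hK.2
    simpa using this.ne
  -- Absolute convergence, from `|ab| ≤ |a|² + |b|²` and the energy identity on each translated
  -- grid.
  have hbound : ∑' n : ℤ × ℤ, ∫⁻ t in tile 0, ‖f (t + toReal n)‖ₑ ≠ ⊤ := by
    rw [← lintegral_tsum fun n => (hfm n).enorm.aemeasurable]
    refine ne_top_of_le_ne_top ?_ (lintegral_mono (g := fun _ =>
      ‖((2 * Real.pi : ℂ) ^ 2)⁻¹‖ₑ ^ 2 * (ENNReal.ofReal ((2 * Real.pi) ^ 2) *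
        ∫⁻ ω, ‖G ω‖ₑ ^ 2 ∂freqMeasure) + ‖((2 * Real.pi : ℂ) ^ 2)⁻¹‖ₑ ^ 2 *
        (ENNReal.ofReal ((2 * Real.pi) ^ 2) * ∫⁻ ω, ‖H ω‖ₑ ^ 2 ∂freqMeasure)) fun t => ?_)
    · rw [setLIntegral_const, volume_tile_zero, mul_one]
      exact ENNReal.add_ne_top.2 ⟨by finiteness [hfin hG], by finiteness [hfin hH]⟩
    · rw [← tsum_enorm_coef_sq hGi t, ← tsum_enorm_coef_sq hHi t, ← ENNReal.tsum_add]
      refine ENNReal.tsum_le_tsum fun n => ?_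
      simp only [hf, enorm_mul, RCLike.enorm_conj]
      rcases le_total ‖coef G (t + toReal n)‖ₑ ‖coef H (t + toReal n)‖ₑ with h | h
      · refine le_trans ?_ le_add_self
        rw [sq]; gcongr
      · refine le_trans ?_ le_self_add
        rw [sq]; gcongr
  have hint : Integrable f (Measure.sum fun n : ℤ × ℤ =>
      (volume.restrict (tile 0)).map fun t => t + toReal n) := by
    rw [← volume_eq_sum_tile]
    refine ⟨hfc.aestronglyMeasurable, ?_⟩
    rw [HasFiniteIntegral, volume_eq_sum_tile, lintegral_sum_measure]
    simp_rw [lintegral_map hfc.enorm.measurable (htr _)]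
    exact lt_top_iff_ne_top.2 hbound
  rw [volume_eq_sum_tile, integral_sum_measure hint]
  simp_rw [integral_map (htr _).aemeasurable hfc.aestronglyMeasurable]
  rw [← integral_tsum (fun n => (hfm n).aestronglyMeasurable) hbound]
  simp_rw [(hsum _).tsum_eq]
  simp [Measure.real, volume_tile_zero]

/-- Plancherel with the second factor translated by `x`. Each interpolation brings a factor `1/s`
and the dilation `t ↦ s t` a Jacobian `s²`, so the sampling interval drops out. -/
theorem contConv_eq_coef {s : ℝ} (hs : 0 < s) {G What : ℝ × ℝ → ℂ}
    (hG : MemLp G 2 freqMeasure) {X : ℤ × ℤ → ℝ} (hX : ∀ n, coef G (toReal n) = X n)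
    {W : ℤ × ℤ → ℂ} (hW : IsDTFT W What) (x : ℝ × ℝ) :
    contConv s W X (s • x) = coef (fun ω => G ω * What ω) x := by
  have hV : MemLp (fun ω => (starRingEnd ℂ) (What ω)) 2 freqMeasure := hW.1.star
  have hs' : (s : ℂ) ≠ 0 := by exact_mod_cast hs.ne'
  have h := integral_coef_mul_conj hG (memLp_mul_chi hV x)
  simp only [coef_mul_chi, map_mul, Complex.conj_conj, conj_chi, ← mul_assoc, zero_sub, neg_neg]
    at h
  rw [← h, contConv, convolution_def]
  simp only [ContinuousLinearMap.lsmul_apply, flip, neg_sub]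
  have hsc := Measure.integral_comp_smul volume
    (fun t => interp s X t • interp s W (t - s • x)) s
  have hfr : Module.finrank ℝ (ℝ × ℝ) = 2 := by simp
  have hs2 : (s : ℂ) ^ 2 ≠ 0 := pow_ne_zero 2 hs'
  rw [hfr, abs_of_pos (by positivity)] at hsc
  have hpt : ∀ t : ℝ × ℝ, interp s X (s • t) • interp s W (s • t - s • x) =
      ((s : ℂ) ^ 2)⁻¹ * (coef G t *
        (starRingEnd ℂ) (coef (fun ω => (starRingEnd ℂ) (What ω)) (t - x))) := fun t => by
    rw [← smul_sub, interp_eq_conj_coef hs hV (coef_of_isDTFT hW), Complex.real_smul,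
      interp_eq_coef hs hG hX]
    field_simp
  simp_rw [hpt, integral_const_mul] at hsc
  rw [Complex.real_smul] at hsc
  push_cast at hsc
  exact (mul_left_cancel₀ (inv_ne_zero hs2) hsc).symm

/-! ### Sampling of band-limited functions -/

/-- Parseval's identity on a subsampled grid, for a function supported in a small square. -/
theorem tsum_enorm_coef_subsample_sq {ξ : ℝ × ℝ} {κ N : ℝ} (hN : 0 < N)
    (hκN : κ ≤ 2 * Real.pi / N) {G k : ℝ × ℝ → ℂ} (hG : Integrable G freqMeasure)
    (hsupp : ∀ᵐ ω ∂freqMeasure, ω ∉ Metric.closedBall ξ (κ / 2) → G ω = 0)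
    (hk : Continuous k) {C : ℝ} (hkC : ∀ ω, ‖k ω‖ ≤ C) :
    ∑' n : ℤ × ℤ, ‖coef (fun ω => G ω * k ω) (N • toReal n)‖ₑ ^ 2 =
      ‖((2 * Real.pi : ℂ) ^ 2)⁻¹‖ₑ ^ 2 * (ENNReal.ofReal ((2 * Real.pi / N) ^ 2) *
        ∫⁻ ω in Metric.closedBall ξ (κ / 2), ‖G ω * k ω‖ₑ ^ 2 ∂freqMeasure) := by
  set P := Metric.closedBall ξ (κ / 2) with hP
  set D : Set (ℝ × ℝ) := Set.Icc (-Real.pi) Real.pi ×ˢ Set.Icc (-Real.pi) Real.pi with hD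
  have hDm : MeasurableSet D := measurableSet_Icc.prod measurableSet_Icc
  have hPm : MeasurableSet P := Metric.isClosed_closedBall.measurableSet
  set L := 2 * Real.pi / N with hL
  have hLpos : 0 < L := by have := Real.pi_pos; positivity
  -- The square of side `L = 2π/N` centred at `ξ` contains the support because `κ ≤ L`, and its
  -- harmonics are the characters of frequency `N n`.
  set B : Set (ℝ × ℝ) := Set.Icc (ξ.1 - L / 2) (ξ.1 - L / 2 + L) ×ˢ
    Set.Icc (ξ.2 - L / 2) (ξ.2 - L / 2 + L) with hB
  have hBm : MeasurableSet B := measurableSet_Icc.prod measurableSet_Icc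
  have hPB : P ⊆ B := by
    intro ω hω
    rw [hP, Metric.mem_closedBall, Prod.dist_eq, max_le_iff, Real.dist_eq, Real.dist_eq,
      abs_le, abs_le] at hω
    simp only [hB, Set.mem_prod, Set.mem_Icc]
    refine ⟨⟨?_, ?_⟩, ?_, ?_⟩ <;> linarith [hω.1.1, hω.1.2, hω.2.1, hω.2.2]
  have hbox : box (ξ.1 - L / 2, ξ.2 - L / 2) L = volume.restrict B := rfl
  have hfreq : freqMeasure = volume.restrict D := rfl
  have hDB : D ∩ P = B ∩ (D ∩ P) := by
    rw [Set.inter_eq_right.2 (Set.inter_subset_right.trans hPB)]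
  have hGk : Integrable (fun ω => G ω * k ω) freqMeasure :=
    hG.mul_bdd hk.aestronglyMeasurable (ae_of_all _ hkC)
  -- Neither `P` nor `B` need lie inside `[-π, π]²`, and `G` is unconstrained outside it; hence the
  -- cutoff to `D ∩ P`.
  set K : ℝ × ℝ → ℂ := (D ∩ P).indicator fun ω => G ω * k ω with hK
  have hKi : Integrable K (box (ξ.1 - L / 2, ξ.2 - L / 2) L) := by
    rw [hbox]
    refine Integrable.restrict ?_
    rw [integrable_indicator_iff (hDm.inter hPm)]
    exact (show IntegrableOn (fun ω => G ω * k ω) D volume from hGk).mono_set Set.inter_subset_left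
  have hint : ∀ x, ∫ ω, G ω * k ω * chi x ω ∂freqMeasure =
      ∫ ω, K ω * chi x ω ∂box (ξ.1 - L / 2, ξ.2 - L / 2) L := by
    intro x
    have h1 : ∫ ω, G ω * k ω * chi x ω ∂freqMeasure =
        ∫ ω in D, P.indicator (fun ω => G ω * k ω * chi x ω) ω := by
      rw [← hfreq]
      refine integral_congr_ae ?_
      filter_upwards [hsupp] with ω hω
      by_cases h : ω ∈ P
      · simp [h]
      · simp [h, hω h]
    have h2 : (fun ω => K ω * chi x ω) =
        (D ∩ P).indicator fun ω => G ω * k ω * chi x ω := by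
      ext1 ω
      by_cases h : ω ∈ D ∩ P
      · simp only [hK, Set.indicator_of_mem h]
      · simp only [hK, Set.indicator_of_notMem h, zero_mul]
    rw [h1, setIntegral_indicator hPm, hbox, h2, setIntegral_indicator (hDm.inter hPm), ← hDB]
  have h := tsum_enorm_integral_chi_sq hLpos hKi
  have hNL : 2 * Real.pi / L = N := by
    have := Real.pi_ne_zero
    rw [hL]; field_simp
  rw [hNL] at h
  simp_rw [coef, hint, enorm_mul, mul_pow, ENNReal.tsum_mul_left, h]
  congr 2
  have h3 : (fun ω => ‖K ω‖ₑ ^ 2) = (D ∩ P).indicator fun ω => ‖G ω * k ω‖ₑ ^ 2 := by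
    ext1 ω
    by_cases h : ω ∈ D ∩ P
    · simp only [hK, Set.indicator_of_mem h]
    · simp [hK, Set.indicator_of_notMem h]
  rw [h3, hbox, setLIntegral_indicator (hDm.inter hPm), hfreq, Measure.restrict_restrict hPm,
    Set.inter_comm P D, Set.inter_comm (D ∩ P) B, ← hDB]
  simp_rw [enorm_mul, mul_pow]

/-! ### Effect of a translation on the sampled moduli -/

theorem abs_dot_le {ω : ℝ × ℝ} {r : ℝ} (hω : ‖ω‖ ≤ r) (u : ℝ × ℝ) :
    |dot ω u| ≤ r * normOne u := by
  have h1 : |ω.1| ≤ r := (norm_fst_le ω).trans hω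
  have h2 : |ω.2| ≤ r := (norm_snd_le ω).trans hω
  calc |dot ω u| ≤ |ω.1| * |u.1| + |ω.2| * |u.2| := by
        rw [dot, ← abs_mul, ← abs_mul]; exact abs_add_le _ _
    _ ≤ r * |u.1| + r * |u.2| := by gcongr
    _ = r * normOne u := by rw [normOne]; ring

/-- From `|exp(it) - 1| ≤ |t|` with `t = ⟨ω - ξ, u⟩`, and the duality of the `ℓ^∞` and `ℓ¹` norms.
-/
theorem norm_chi_mul_chi_sub_one_le {ξ ω : ℝ × ℝ} {r : ℝ} (hω : ω ∈ Metric.closedBall ξ r)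
    (u : ℝ × ℝ) : ‖chi u ω * chi (-u) ξ - 1‖ ≤ r * normOne u := by
  have h : chi u ω * chi (-u) ξ = Complex.exp (Complex.I * (dot (ω - ξ) u : ℂ)) := by
    rw [chi, chi, ← Complex.exp_add]
    congr 1
    simp [dot]
    ring
  rw [h]
  refine (Real.norm_exp_I_mul_ofReal_sub_one_le).trans ?_
  exact abs_dot_le (by simpa [dist_eq_norm] using hω) u

/-- The energy of the samples on a subsampled grid is invariant under translation. -/
theorem tsum_enorm_coef_sub_sq {ξ : ℝ × ℝ} {κ N : ℝ} (hN : 0 < N)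
    (hκN : κ ≤ 2 * Real.pi / N) {G : ℝ × ℝ → ℂ} (hG : Integrable G freqMeasure)
    (hsupp : ∀ᵐ ω ∂freqMeasure, ω ∉ Metric.closedBall ξ (κ / 2) → G ω = 0) (u : ℝ × ℝ) :
    ∑' n : ℤ × ℤ, ‖coef G (N • toReal n - u)‖ₑ ^ 2 =
      ∑' n : ℤ × ℤ, ‖coef G (N • toReal n)‖ₑ ^ 2 := by
  have h1 := tsum_enorm_coef_subsample_sq hN hκN hG hsupp (continuous_chi_right u)
    fun ω => (norm_chi u ω).le
  have h0 := tsum_enorm_coef_subsample_sq hN hκN hG hsupp (continuous_chi_right 0)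
    fun ω => (norm_chi 0 ω).le
  simp only [coef_mul_chi, sub_zero] at h0 h1
  rw [h0, h1]
  simp_rw [enorm_mul, ← ofReal_norm (chi _ _), norm_chi]

/-- Near shift invariance of the moduli of samples of a function with a small frequency support. -/
theorem tsum_enorm_norm_coef_sub_norm_coef_sq_le {ξ : ℝ × ℝ} {κ N : ℝ} (hκ : 0 < κ) (hN : 0 < N)
    (hκN : κ ≤ 2 * Real.pi / N) {G : ℝ × ℝ → ℂ} (hG : Integrable G freqMeasure)
    (hsupp : ∀ᵐ ω ∂freqMeasure, ω ∉ Metric.closedBall ξ (κ / 2) → G ω = 0) (u : ℝ × ℝ) :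
    ∑' n : ℤ × ℤ, ‖‖coef G (N • toReal n - u)‖ - ‖coef G (N • toReal n)‖‖ₑ ^ 2 ≤
      ENNReal.ofReal (alphaFun (κ • u)) ^ 2 *
        ∑' n : ℤ × ℤ, ‖coef G (N • toReal n)‖ₑ ^ 2 := by
  -- Moduli ignore unimodular constants, so the translate may first be multiplied by `chi (-u) ξ`;
  -- `k` is the multiplier of the resulting difference, small on the support. The reverse triangle
  -- inequality then bounds the difference of moduli.
  set k : ℝ × ℝ → ℂ := fun ω => chi u ω * chi (-u) ξ - 1 with hk
  have hkc : Continuous k := ((continuous_chi_right u).mul continuous_const).sub continuous_const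
  have h1 := tsum_enorm_coef_subsample_sq (C := 2) hN hκN hG hsupp hkc fun ω => by
    refine (norm_sub_le _ _).trans ?_
    simp
    norm_num
  have h0 := tsum_enorm_coef_subsample_sq hN hκN hG hsupp (continuous_chi_right 0)
    fun ω => (norm_chi 0 ω).le
  simp only [chi_zero, mul_one] at h0
  have hcoef : ∀ x, coef (fun ω => G ω * k ω) x = chi (-u) ξ * coef G (x - u) - coef G x := by
    intro x
    have : ∀ ω, G ω * k ω * chi (-x) ω =
        chi (-u) ξ * (G ω * chi u ω * chi (-x) ω) - G ω * chi (-x) ω := fun ω => by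
      simp only [hk]; ring
    rw [← coef_mul_chi]
    simp only [coef, this]
    rw [integral_sub ((integrable_mul_chi (integrable_mul_chi hG _) _).const_mul _)
      (integrable_mul_chi hG _), integral_const_mul]
    ring
  have hα : alphaFun (κ • u) = κ / 2 * normOne u := by
    simp only [alphaFun, normOne, Prod.smul_fst, Prod.smul_snd, smul_eq_mul, abs_mul,
      abs_of_pos hκ]
    ring
  calc ∑' n : ℤ × ℤ, ‖‖coef G (N • toReal n - u)‖ - ‖coef G (N • toReal n)‖‖ₑ ^ 2
      ≤ ∑' n : ℤ × ℤ, ‖coef (fun ω => G ω * k ω) (N • toReal n)‖ₑ ^ 2 := by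
        refine ENNReal.tsum_le_tsum fun n => ?_
        gcongr ?_ ^ 2
        rw [hcoef, enorm_le_iff_norm_le]
        have := abs_norm_sub_norm_le (chi (-u) ξ * coef G (N • toReal n - u))
          (coef G (N • toReal n))
        rwa [norm_mul, norm_chi, one_mul] at this
    _ ≤ _ := by
        have hI : ∫⁻ ω in Metric.closedBall ξ (κ / 2), ‖G ω * k ω‖ₑ ^ 2 ∂freqMeasure ≤
            ENNReal.ofReal (alphaFun (κ • u)) ^ 2 *
              ∫⁻ ω in Metric.closedBall ξ (κ / 2), ‖G ω‖ₑ ^ 2 ∂freqMeasure := by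
          rw [← lintegral_const_mul'' _ (hG.1.enorm.pow_const 2).restrict]
          refine setLIntegral_mono_ae' Metric.isClosed_closedBall.measurableSet
            (ae_of_all _ fun ω hω => ?_)
          rw [← mul_pow, enorm_mul, mul_comm ‖G ω‖ₑ]
          gcongr
          rw [← ofReal_norm]
          exact ENNReal.ofReal_le_ofReal (hα ▸ norm_chi_mul_chi_sub_one_le hω u)
        rw [h1, h0, mul_left_comm (ENNReal.ofReal (alphaFun (κ • u)) ^ 2),
          mul_left_comm (ENNReal.ofReal (alphaFun (κ • u)) ^ 2)]
        gcongr

/-! ### The filtered process -/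

theorem memℓp_ofReal {X : ℤ × ℤ → ℝ} (hX : Memℓp X 2) : Memℓp (fun n => (X n : ℂ)) 2 := by
  refine memℓp_gen ?_
  simpa using hX.summable (by norm_num)

theorem memℓp_of_ofReal {X : ℤ × ℤ → ℝ} (hX : Memℓp (fun n => (X n : ℂ)) 2) : Memℓp X 2 := by
  refine memℓp_gen ?_
  simpa using hX.summable (by norm_num)

theorem memℓp_shift {s : ℝ} (hs : 0 < s) {X : ℤ × ℤ → ℝ} (hX : Memℓp X 2) (u : ℝ × ℝ) :
    Memℓp (shift s u X) 2 := by
  obtain ⟨G, hG, hGX⟩ := exists_coef_eq (memℓp_ofReal hX)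
  have h := memℓp_coef (memLp_mul_chi hG u)
  simp only [coef_eq_shift hs hG hGX] at h
  exact memℓp_of_ofReal h

/-- Lets every statement about translates cover the original sequence as well. -/
theorem shift_zero {s : ℝ} (hs : 0 < s) {X : ℤ × ℤ → ℝ} (hX : Memℓp X 2) : shift s 0 X = X := by
  obtain ⟨G, hG, hGX⟩ := exists_coef_eq (memℓp_ofReal hX)
  ext n
  have h := coef_eq_shift hs hG hGX 0 n
  rw [coef_mul_chi, sub_zero, hGX] at h
  exact_mod_cast h.symm

theorem summable_interp {s : ℝ} (hs : 0 < s) {X : ℤ × ℤ → ℝ} (hX : Memℓp X 2) (x : ℝ × ℝ) :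
    Summable fun n => sincKernel s (x - s • toReal n) • X n := by
  obtain ⟨G, hG, hGX⟩ := exists_coef_eq (memℓp_ofReal hX)
  have h := (hasSum_interp hs hG (s⁻¹ • x)).summable
  simp only [hGX, smul_inv_smul₀ hs.ne'] at h
  rw [← Complex.summable_ofReal]
  exact h.congr fun n => by simp

theorem summable_conv {ξ : ℝ × ℝ} {κ : ℝ} {W : ℤ × ℤ → ℂ} (hW : W ∈ gaborFilters ξ κ)
    {X : ℤ × ℤ → ℝ} (hX : Memℓp X 2) (j : ℤ × ℤ) :
    Summable fun k => X k • flip W (j - k) := by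
  obtain ⟨G, hG, hGX⟩ := exists_coef_eq (memℓp_ofReal hX)
  obtain ⟨_, What, hWhat, _⟩ := hW
  exact (hasSum_conv hG hGX hWhat j).summable

/-- Sampling on the integer grid and translation of the function `F_X * ψ̄`. -/
theorem contConv_shift {s : ℝ} (hs : 0 < s) {ξ : ℝ × ℝ} {κ : ℝ} {W : ℤ × ℤ → ℂ}
    (hW : W ∈ gaborFilters ξ κ) {X : ℤ × ℤ → ℝ} (hX : Memℓp X 2) (u x : ℝ × ℝ) :
    contConv s W (shift s u X) x = contConv s W X (x - s • u) := by
  obtain ⟨G, hG, hGX⟩ := exists_coef_eq (memℓp_ofReal hX)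
  obtain ⟨_, What, hWhat, _⟩ := hW
  have h := contConv_eq_coef hs (memLp_mul_chi hG u) (coef_eq_shift hs hG hGX u) hWhat (s⁻¹ • x)
  have h2 := contConv_eq_coef hs hG hGX hWhat (s⁻¹ • x - u)
  rw [smul_sub, smul_inv_smul₀ hs.ne'] at h2
  rw [smul_inv_smul₀ hs.ne'] at h
  rw [h, h2, ← coef_mul_chi]
  congr 1
  ext1 ω
  ring

theorem conv_eq_contConv {s : ℝ} (hs : 0 < s) {ξ : ℝ × ℝ} {κ : ℝ} {W : ℤ × ℤ → ℂ}
    (hW : W ∈ gaborFilters ξ κ) {X : ℤ × ℤ → ℝ} (hX : Memℓp X 2) (j : ℤ × ℤ) :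
    conv X (flip W) j = contConv s W X (s • toReal j) := by
  obtain ⟨G, hG, hGX⟩ := exists_coef_eq (memℓp_ofReal hX)
  obtain ⟨_, What, hWhat, _⟩ := hW
  rw [conv_eq_coef hG hGX hWhat, contConv_eq_coef hs hG hGX hWhat]

theorem cgmod_shift {s : ℝ} (hs : 0 < s) {ξ : ℝ × ℝ} {κ : ℝ} {W : ℤ × ℤ → ℂ}
    (hW : W ∈ gaborFilters ξ κ) {X : ℤ × ℤ → ℝ} (hX : Memℓp X 2) (m : ℕ) (u : ℝ × ℝ)
    (n : ℤ × ℤ) :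
    cgmod m W (shift s u X) n = modulus s W X ((m * s) • toReal n - s • u) := by
  rw [cgmod, down, conv_eq_contConv hs hW (memℓp_shift hs hX u), contConv_shift hs hW hX,
    modulus, toReal_nsmul, smul_smul, mul_comm s]

theorem l2norm_eq_tsum (Y : ℤ × ℤ → ℝ) : l2norm Y = (∑' n, ‖Y n‖ₑ ^ 2) ^ (1 / 2 : ℝ) := by
  rw [l2norm, eLpNorm_eq_lintegral_rpow_enorm_toReal (by norm_num) (by norm_num), lintegral_count]
  simp

/-- A single spectrum serves all translations and subsampling factors. Being a product of two `L²`
functions, it is only known to be integrable, which is why the Parseval identities used on it allow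
infinite energies. -/
theorem exists_cgmod_eq_norm_coef {s : ℝ} (hs : 0 < s) {ξ : ℝ × ℝ} {κ : ℝ} {W : ℤ × ℤ → ℂ}
    (hW : W ∈ gaborFilters ξ κ) {X : ℤ × ℤ → ℝ} (hX : Memℓp X 2) :
    ∃ G : ℝ × ℝ → ℂ, Integrable G freqMeasure ∧
      (∀ᵐ ω ∂freqMeasure, ω ∉ Metric.closedBall ξ (κ / 2) → G ω = 0) ∧
      ∀ (m : ℕ) (u : ℝ × ℝ) (n : ℤ × ℤ),
        cgmod m W (shift s u X) n = ‖coef G ((m : ℝ) • toReal n - u)‖ := by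
  obtain ⟨F, hF, hFX⟩ := exists_coef_eq (memℓp_ofReal hX)
  obtain ⟨What, hWhat, hsupp⟩ := hW.2
  refine ⟨fun ω => F ω * What ω, hF.integrable_mul hWhat.1, ?_, fun m u n => ?_⟩
  · filter_upwards [hsupp] with ω hω h
    rw [hω h, mul_zero]
  · rw [cgmod_shift hs hW hX, modulus, ← contConv_eq_coef hs hF hFX hWhat, smul_sub, smul_smul,
      mul_comm s]

theorem l2norm_cgmod_shift {s : ℝ} (hs : 0 < s) {ξ : ℝ × ℝ} {κ : ℝ} {W : ℤ × ℤ → ℂ}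
    (hW : W ∈ gaborFilters ξ κ) {X : ℤ × ℤ → ℝ} (hX : Memℓp X 2) {m : ℕ} (hm : 1 ≤ m)
    (hκm : κ ≤ Real.pi / m) (u : ℝ × ℝ) :
    l2norm (cgmod (2 * m) W (shift s u X)) = l2norm (cgmod (2 * m) W X) := by
  obtain ⟨G, hG, hsupp, h⟩ := exists_cgmod_eq_norm_coef hs hW hX
  have hm' : (0 : ℝ) < m := by exact_mod_cast hm
  have hN : (0 : ℝ) < (2 * m : ℕ) := by push_cast; positivity
  -- The bandwidth condition `κ ≤ π/m` is the absence of aliasing for subsampling by `2m`.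
  have hκN : κ ≤ 2 * Real.pi / (2 * m : ℕ) := by
    push_cast; rwa [mul_div_mul_left _ _ two_ne_zero]
  conv_rhs => rw [← shift_zero hs hX]
  rw [l2norm_eq_tsum, l2norm_eq_tsum]
  simp_rw [h, enorm_norm, tsum_enorm_coef_sub_sq hN hκN hG hsupp]

theorem l2norm_cgmod_shift_sub_le {s : ℝ} (hs : 0 < s) {ξ : ℝ × ℝ} {κ : ℝ} (hκ : 0 < κ)
    {W : ℤ × ℤ → ℂ} (hW : W ∈ gaborFilters ξ κ) {X : ℤ × ℤ → ℝ} (hX : Memℓp X 2) {m : ℕ}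
    (hm : 1 ≤ m) (hκm : κ ≤ Real.pi / m) (u : ℝ × ℝ) :
    l2norm (cgmod (2 * m) W (shift s u X) - cgmod (2 * m) W X) ≤
      ENNReal.ofReal (alphaFun (κ • u)) * l2norm (cgmod (2 * m) W X) := by
  obtain ⟨G, hG, hsupp, h⟩ := exists_cgmod_eq_norm_coef hs hW hX
  have hm' : (0 : ℝ) < m := by exact_mod_cast hm
  have hN : (0 : ℝ) < (2 * m : ℕ) := by push_cast; positivity
  have hκN : κ ≤ 2 * Real.pi / (2 * m : ℕ) := by
    push_cast; rwa [mul_div_mul_left _ _ two_ne_zero]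
  have h0 : ∀ n, cgmod (2 * m) W X n = ‖coef G (((2 * m : ℕ) : ℝ) • toReal n)‖ := fun n => by
    rw [← sub_zero (((2 * m : ℕ) : ℝ) • toReal n), ← h, shift_zero hs hX]
  rw [l2norm_eq_tsum, l2norm_eq_tsum]
  simp_rw [Pi.sub_apply, h, h0, enorm_norm]
  have := ENNReal.rpow_le_rpow
    (tsum_enorm_norm_coef_sub_norm_coef_sq_le hκ hN hκN hG hsupp u) (by norm_num : (0:ℝ) ≤ 1 / 2)
  rw [ENNReal.mul_rpow_of_nonneg _ _ (by norm_num)] at this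
  refine this.trans_eq ?_
  congr 1
  rw [← ENNReal.rpow_natCast, ← ENNReal.rpow_mul]
  norm_num

/-! ### The mean square of the phase defect -/

/-- The defect `1 - max_k cos(⟨ζ, k⟩ - θ)` at `z = exp(iθ)`. -/
def phaseDefect (q : ℕ) (ζ : ℝ × ℝ) (z : ℂ) : ℝ :=
  1 - gridMax q fun k => (chi (toReal k) ζ * (starRingEnd ℂ) z).re

theorem re_chi_mul_conj_exp (x ζ : ℝ × ℝ) (θ : ℝ) :
    (chi x ζ * (starRingEnd ℂ) (Complex.exp (Complex.I * (θ : ℂ)))).re =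
      Real.cos (dot ζ x - θ) := by
  rw [chi, ← Complex.exp_conj, ← Complex.exp_add, map_mul, Complex.conj_I, Complex.conj_ofReal,
    show Complex.I * (dot ζ x : ℂ) + -Complex.I * (θ : ℂ) = ((dot ζ x - θ : ℝ) : ℂ) * Complex.I by
      push_cast; ring, Complex.exp_ofReal_mul_I_re]

/-- Written with `Re (χ z̄)` instead of an angle, the defect avoids the jump of the argument, so its
composition with the unit phase is measurable. -/
theorem continuous_phaseDefect (q : ℕ) (ζ : ℝ × ℝ) : Continuous (phaseDefect q ζ) := by
  refine continuous_const.sub ?_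
  unfold gridMax
  refine Continuous.finset_sup'_apply _ fun k _ => ?_
  fun_prop

theorem phaseDefect_nonneg (q : ℕ) (ζ : ℝ × ℝ) {z : ℂ} (hz : ‖z‖ ≤ 1) :
    0 ≤ phaseDefect q ζ z := by
  rw [phaseDefect, sub_nonneg, gridMax, Finset.sup'_le_iff]
  intro k _
  refine (Complex.re_le_norm _).trans ?_
  rw [norm_mul, norm_chi, one_mul, RCLike.norm_conj]
  exact hz

theorem phaseDefect_exp_le {q : ℕ} (ζ : ℝ × ℝ) {k : ℤ × ℤ} (hk : k ∈ grid q) (θ : ℝ) :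
    phaseDefect q ζ (Complex.exp (Complex.I * (θ : ℂ))) ≤
      1 - Real.cos (dot ζ (toReal k) - θ) := by
  rw [phaseDefect, ← re_chi_mul_conj_exp]
  exact sub_le_sub_left (Finset.le_sup'
    (f := fun k => (chi (toReal k) ζ * (starRingEnd ℂ) (Complex.exp (Complex.I * (θ : ℂ)))).re)
    hk) 1

/-! ### Sorted grid angles and integration gap by gap -/

theorem angle_nonneg (z : ℂ) : 0 ≤ angle z := left_le_toIcoMod _ _ _

theorem angle_lt_two_pi (z : ℂ) : angle z < 2 * Real.pi := by
  simpa [angle] using toIcoMod_lt_right Real.two_pi_pos 0 z.arg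

theorem cos_angle_exp_sub (t θ : ℝ) :
    Real.cos (angle (Complex.exp (Complex.I * (t : ℂ))) - θ) = Real.cos (t - θ) := by
  have h1 : angle (Complex.exp (Complex.I * (t : ℂ))) = t -
      ((toIocDiv Real.two_pi_pos (-Real.pi) t + toIcoDiv Real.two_pi_pos 0
        (toIocMod Real.two_pi_pos (-Real.pi) t) : ℤ) : ℝ) * (2 * Real.pi) := by
    rw [angle, mul_comm Complex.I, Complex.arg_exp_mul_I, toIcoMod, toIocMod]
    push_cast [zsmul_eq_mul]
    ring
  rw [h1, sub_right_comm, Real.cos_sub_int_mul_two_pi]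

theorem length_gridAngles (q : ℕ) (ζ : ℝ × ℝ) : (gridAngles q ζ).length = (2 * q + 1) ^ 2 := by
  rw [gridAngles, Multiset.length_sort, Multiset.card_map]
  have : (Finset.Icc (-(q : ℤ)) q).card = 2 * q + 1 := by
    rw [Int.card_Icc]
    lia
  rw [Finset.card_val, grid, Finset.card_product, this, sq]

theorem mem_gridAngles {q : ℕ} {ζ : ℝ × ℝ} {a : ℝ} (ha : a ∈ gridAngles q ζ) :
    0 ≤ a ∧ a < 2 * Real.pi ∧
      ∃ k ∈ grid q, ∀ θ, Real.cos (a - θ) = Real.cos (dot ζ (toReal k) - θ) := by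
  rw [gridAngles, Multiset.mem_sort, Multiset.mem_map] at ha
  obtain ⟨k, hk, rfl⟩ := ha
  exact ⟨angle_nonneg _, angle_lt_two_pi _, k, hk, fun θ => cos_angle_exp_sub _ _⟩

theorem zero_mem_grid (q : ℕ) : (0 : ℤ × ℤ) ∈ grid q := by simp [grid]

theorem zero_mem_gridAngles (q : ℕ) (ζ : ℝ × ℝ) : (0 : ℝ) ∈ gridAngles q ζ := by
  rw [gridAngles, Multiset.mem_sort, Multiset.mem_map]
  exact ⟨0, zero_mem_grid q, by simp [dot, toReal, angle]⟩

/-- The default value `2π` plays the role of the final angle; all listed angles lie below it, so the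
extended sequence stays monotone. -/
theorem gridAngles_getD_mono (q : ℕ) (ζ : ℝ × ℝ) (i : ℕ) :
    (gridAngles q ζ).getD i (2 * Real.pi) ≤ (gridAngles q ζ).getD (i + 1) (2 * Real.pi) := by
  by_cases h1 : i + 1 < (gridAngles q ζ).length
  · rw [List.getD_eq_getElem _ _ h1, List.getD_eq_getElem _ _ ((Nat.lt_succ_self i).trans h1)]
    exact List.pairwise_iff_getElem.1 (Multiset.pairwise_sort _ _) i (i + 1) _ h1
      (Nat.lt_succ_self i)
  · rw [List.getD_eq_default _ _ (not_lt.1 h1)]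
    by_cases h2 : i < (gridAngles q ζ).length
    · rw [List.getD_eq_getElem _ _ h2]
      exact (mem_gridAngles (List.getElem_mem h2)).2.1.le
    · rw [List.getD_eq_default _ _ (not_lt.1 h2)]

theorem gridAngles_getD_zero (q : ℕ) (ζ : ℝ × ℝ) :
    (gridAngles q ζ).getD 0 (2 * Real.pi) = 0 := by
  obtain ⟨i, hi, h0⟩ := List.getElem_of_mem (zero_mem_gridAngles q ζ)
  have hlen : 0 < (gridAngles q ζ).length := (Nat.zero_le i).trans_lt hi
  have hmono : Monotone fun i => (gridAngles q ζ).getD i (2 * Real.pi) :=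
    monotone_nat_of_le_succ (gridAngles_getD_mono q ζ)
  refine le_antisymm ?_ ?_
  · rw [← h0, ← List.getD_eq_getElem _ (2 * Real.pi) hi]
    exact hmono (Nat.zero_le i)
  · rw [List.getD_eq_getElem _ _ hlen]
    exact (mem_gridAngles (List.getElem_mem hlen)).1

/-- The closing value `2π` is also a grid angle modulo `2π`, that of `k = 0`; so both endpoints of
every gap come from grid points. -/
theorem exists_grid_cos_getD (q : ℕ) (ζ : ℝ × ℝ) (i : ℕ) :
    ∃ k ∈ grid q, ∀ θ, Real.cos ((gridAngles q ζ).getD i (2 * Real.pi) - θ) =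
      Real.cos (dot ζ (toReal k) - θ) := by
  by_cases h : i < (gridAngles q ζ).length
  · rw [List.getD_eq_getElem _ _ h]
    exact (mem_gridAngles (List.getElem_mem h)).2.2
  · rw [List.getD_eq_default _ _ (not_lt.1 h)]
    refine ⟨0, zero_mem_grid q, fun θ => ?_⟩
    simp [dot, toReal, Real.cos_two_pi_sub]

theorem integral_one_sub_cos_sq (c a b : ℝ) :
    ∫ θ in a..b, (1 - Real.cos (c - θ)) ^ 2 =
      (3 / 2 * (b - c) - 2 * Real.sin (b - c) + Real.sin (2 * (b - c)) / 4) -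
      (3 / 2 * (a - c) - 2 * Real.sin (a - c) + Real.sin (2 * (a - c)) / 4) := by
  refine intervalIntegral.integral_eq_sub_of_hasDerivAt
    (f := fun θ => 3 / 2 * (θ - c) - 2 * Real.sin (θ - c) + Real.sin (2 * (θ - c)) / 4)
    (fun θ _ => ?_) (Continuous.intervalIntegrable (by fun_prop) _ _)
  have h1 : HasDerivAt (fun θ : ℝ => θ - c) 1 θ := (hasDerivAt_id θ).sub_const c
  have h := ((h1.const_mul (3 / 2 : ℝ)).sub (h1.sin.const_mul 2)).add
    (((h1.const_mul (2 : ℝ)).sin).div_const 4)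
  refine h.congr_deriv ?_
  rw [Real.cos_two_mul, ← neg_sub θ c, Real.cos_neg]
  ring

/-- Cut the gap, of length `δ`, at its midpoint and keep in the maximum only the cosine of the
nearer endpoint. Each half contributes `3δ/4 - 2 sin(δ/2) + sin(δ)/4`. -/
theorem integral_phaseDefect_sq_le_gap (q : ℕ) (ζ : ℝ × ℝ) (i : ℕ) :
    ∫ θ in (gridAngles q ζ).getD i (2 * Real.pi)..(gridAngles q ζ).getD (i + 1) (2 * Real.pi),
      phaseDefect q ζ (Complex.exp (Complex.I * (θ : ℂ))) ^ 2 ≤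
      3 / 2 * gap q ζ i + 1 / 2 * (Real.sin (gap q ζ i) - 8 * Real.sin (gap q ζ i / 2)) := by
  have hab := gridAngles_getD_mono q ζ i
  obtain ⟨k, hk, hkc⟩ := exists_grid_cos_getD q ζ i
  obtain ⟨l, hl, hlc⟩ := exists_grid_cos_getD q ζ (i + 1)
  rw [gap]
  set a := (gridAngles q ζ).getD i (2 * Real.pi)
  set b := (gridAngles q ζ).getD (i + 1) (2 * Real.pi)
  have hc : Continuous fun θ : ℝ => phaseDefect q ζ (Complex.exp (Complex.I * (θ : ℂ))) ^ 2 :=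
    ((continuous_phaseDefect q ζ).comp (by fun_prop)).pow 2
  have hnn : ∀ θ : ℝ, 0 ≤ phaseDefect q ζ (Complex.exp (Complex.I * (θ : ℂ))) := fun θ =>
    phaseDefect_nonneg q ζ (by rw [mul_comm, Complex.norm_exp_ofReal_mul_I])
  have hle : ∀ c x y, x ≤ y → (∃ k ∈ grid q, ∀ θ, Real.cos (c - θ) =
      Real.cos (dot ζ (toReal k) - θ)) →
      ∫ θ in x..y, phaseDefect q ζ (Complex.exp (Complex.I * (θ : ℂ))) ^ 2 ≤
        ∫ θ in x..y, (1 - Real.cos (c - θ)) ^ 2 := by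
    rintro c x y hxy ⟨k, hk, hkc⟩
    refine intervalIntegral.integral_mono_on hxy (hc.intervalIntegrable _ _)
      (Continuous.intervalIntegrable (by fun_prop) _ _) fun θ _ => ?_
    exact pow_le_pow_left₀ (hnn θ) ((phaseDefect_exp_le ζ hk θ).trans_eq (by rw [hkc])) 2
  rw [← intervalIntegral.integral_add_adjacent_intervals
    (hc.intervalIntegrable a ((a + b) / 2)) (hc.intervalIntegrable ((a + b) / 2) b)]
  refine (add_le_add (hle a a _ (by linarith) ⟨k, hk, hkc⟩)
    (hle b _ b (by linarith) ⟨l, hl, hlc⟩)).trans_eq ?_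
  rw [integral_one_sub_cos_sq, integral_one_sub_cos_sq,
    show (a + b) / 2 - a = (b - a) / 2 by ring, show (a + b) / 2 - b = -((b - a) / 2) by ring]
  simp only [mul_neg, mul_div_cancel₀ (b - a) (two_ne_zero' ℝ), sub_self, mul_zero,
    Real.sin_zero, Real.sin_neg]
  ring

theorem integral_phaseDefect_sq_le (q : ℕ) (ζ : ℝ × ℝ) :
    (2 * Real.pi)⁻¹ * ∫ θ in (0 : ℝ)..2 * Real.pi,
      phaseDefect q ζ (Complex.exp (Complex.I * (θ : ℂ))) ^ 2 ≤
      3 / 2 + 1 / (4 * Real.pi) * ∑ i ∈ Finset.range ((2 * q + 1) ^ 2),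
        (Real.sin (gap q ζ i) - 8 * Real.sin (gap q ζ i / 2)) := by
  have hpi := Real.pi_pos
  have hc : Continuous fun θ : ℝ => phaseDefect q ζ (Complex.exp (Complex.I * (θ : ℂ))) ^ 2 :=
    ((continuous_phaseDefect q ζ).comp (by fun_prop)).pow 2
  have hN : (gridAngles q ζ).getD ((2 * q + 1) ^ 2) (2 * Real.pi) = 2 * Real.pi :=
    List.getD_eq_default _ _ (length_gridAngles q ζ).le
  have hsum := intervalIntegral.sum_integral_adjacent_intervals
    (a := fun i => (gridAngles q ζ).getD i (2 * Real.pi)) (n := (2 * q + 1) ^ 2) (μ := volume)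
    fun k _ => hc.intervalIntegrable _ _
  -- The gaps telescope to the full circle; their linear terms average to the constant `3/2`.
  have hgap : ∑ i ∈ Finset.range ((2 * q + 1) ^ 2), gap q ζ i = 2 * Real.pi := by
    simp only [gap]
    rw [Finset.sum_range_sub fun i => (gridAngles q ζ).getD i (2 * Real.pi), hN,
      gridAngles_getD_zero, sub_zero]
  rw [hN, gridAngles_getD_zero] at hsum
  rw [← hsum]
  have h := Finset.sum_le_sum fun i (_ : i ∈ Finset.range ((2 * q + 1) ^ 2)) =>
    integral_phaseDefect_sq_le_gap q ζ i
  rw [Finset.sum_add_distrib, ← Finset.mul_sum, ← Finset.mul_sum, hgap] at h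
  refine (mul_le_mul_of_nonneg_left h (by positivity)).trans_eq ?_
  field_simp
  ring

theorem lintegral_phaseDefect_sq_le (q : ℕ) (ζ : ℝ × ℝ) :
    ∫⁻ z, ‖phaseDefect q ζ z‖ₑ ^ 2 ∂uniformCircle ≤ ENNReal.ofReal (gammaFun q ζ) ^ 2 := by
  have hpi := Real.two_pi_pos
  have hcd := continuous_phaseDefect q ζ
  have hc : Continuous fun θ : ℝ => phaseDefect q ζ (Complex.exp (Complex.I * (θ : ℂ))) ^ 2 :=
    (hcd.comp (by fun_prop)).pow 2
  have hm : Measurable fun θ : ℝ => Complex.exp (Complex.I * (θ : ℂ)) := by fun_prop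
  have hsq : ∀ x : ℝ, ‖x‖ₑ ^ 2 = ENNReal.ofReal (x ^ 2) := fun x => by
    rw [← ofReal_norm, ← ENNReal.ofReal_pow (norm_nonneg _), Real.norm_eq_abs, sq_abs]
  have hI : ∫⁻ θ in Set.Ico 0 (2 * Real.pi),
      ‖phaseDefect q ζ (Complex.exp (Complex.I * (θ : ℂ)))‖ₑ ^ 2 =
      ENNReal.ofReal (∫ θ in (0 : ℝ)..2 * Real.pi,
        phaseDefect q ζ (Complex.exp (Complex.I * (θ : ℂ))) ^ 2) := by
    rw [intervalIntegral.integral_of_le hpi.le, ← integral_Ico_eq_integral_Ioc,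
      ofReal_integral_eq_lintegral_ofReal
        (hc.integrableOn_Icc.mono_set Set.Ico_subset_Icc_self) (ae_of_all _ fun _ => sq_nonneg _)]
    simp_rw [hsq]
  rw [uniformCircle, lintegral_map (hcd.measurable.enorm.pow_const 2) hm, ProbabilityTheory.cond,
    lintegral_smul_measure, hI, Real.volume_Ico, sub_zero, ← ENNReal.ofReal_inv_of_pos hpi,
    smul_eq_mul, ← ENNReal.ofReal_mul (by positivity), gammaFun,
    ← ENNReal.ofReal_pow (Real.sqrt_nonneg _)]
  have h := integral_phaseDefect_sq_le q ζ
  -- The radicand of `gammaFun` bounds a mean square, hence is nonnegative, and squaring the root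
  -- recovers it.
  rw [Real.sq_sqrt]
  · exact ENNReal.ofReal_le_ofReal h
  · refine le_trans (mul_nonneg (by positivity) ?_) h
    exact intervalIntegral.integral_nonneg hpi.le fun _ _ => sq_nonneg _

/-! ### Measurability -/

theorem measurable_tsum_of_summable {Ω ι E : Type*} [MeasurableSpace Ω] [Countable ι]
    [NormedAddCommGroup E] [MeasurableSpace E] [BorelSpace E] [MeasurableAdd₂ E]
    {f : ι → Ω → E} (hf : ∀ i, Measurable (f i)) (hs : ∀ ω, Summable fun i => f i ω) :
    Measurable fun ω => ∑' i, f i ω :=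
  measurable_of_tendsto_metrizable' atTop
    (fun S : Finset ι => Finset.measurable_fun_sum S fun i _ => hf i)
    (tendsto_pi_nhds.2 fun ω => (hs ω).hasSum)

section RandomSequence

variable {Ω : Type*} [MeasurableSpace Ω] {X : Ω → ℤ × ℤ → ℝ}

theorem measurable_shift {s : ℝ} (hs : 0 < s) (hXm : ∀ n, Measurable fun ω => X ω n)
    (hX : ∀ ω, Memℓp (X ω) 2) (u : ℝ × ℝ) (n : ℤ × ℤ) :
    Measurable fun ω => shift s u (X ω) n := by
  have h : Measurable fun ω => interp s (X ω) (s • toReal n - s • u) :=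
    measurable_tsum_of_summable
      (f := fun k ω => sincKernel s (s • toReal n - s • u - s • toReal k) • X ω k)
      (fun k => (hXm k).const_mul _) fun ω => summable_interp hs (hX ω) _
  exact h.const_mul s

theorem measurable_conv {ξ : ℝ × ℝ} {κ : ℝ} {W : ℤ × ℤ → ℂ} (hW : W ∈ gaborFilters ξ κ)
    (hXm : ∀ n, Measurable fun ω => X ω n) (hX : ∀ ω, Memℓp (X ω) 2) (j : ℤ × ℤ) :
    Measurable fun ω => conv (X ω) (flip W) j :=
  measurable_tsum_of_summable (fun k => (hXm k).smul_const _) fun ω => summable_conv hW (hX ω) j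

theorem measurable_conv_re {ξ : ℝ × ℝ} {κ : ℝ} {W : ℤ × ℤ → ℂ} (hW : W ∈ gaborFilters ξ κ)
    (hXm : ∀ n, Measurable fun ω => X ω n) (hX : ∀ ω, Memℓp (X ω) 2) (j : ℤ × ℤ) :
    Measurable fun ω => conv (X ω) (flip fun n => (W n).re) j :=
  measurable_tsum_of_summable (fun k => (hXm k).smul_const _) fun ω =>
    ((Complex.hasSum_re (summable_conv hW (hX ω) j).hasSum).summable).congr fun k => by
      simp [flip]

theorem measurable_rgpool {ξ : ℝ × ℝ} {κ : ℝ} {W : ℤ × ℤ → ℂ} (hW : W ∈ gaborFilters ξ κ)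
    (hXm : ∀ n, Measurable fun ω => X ω n) (hX : ∀ ω, Memℓp (X ω) 2) (m q : ℕ) (n : ℤ × ℤ) :
    Measurable fun ω => rgpool m q W (X ω) n := by
  unfold rgpool maxpool gridMax
  have := Finset.measurable_sup' (grid_nonempty q) (f := fun k ω =>
    down m (conv (X ω) (flip fun n => (W n).re)) (2 • n + k)) fun k _ =>
      measurable_conv_re hW hXm hX _
  convert! this using 1
  ext ω
  rw [Finset.sup'_apply]

theorem measurable_cgmod {ξ : ℝ × ℝ} {κ : ℝ} {W : ℤ × ℤ → ℂ} (hW : W ∈ gaborFilters ξ κ)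
    (hXm : ∀ n, Measurable fun ω => X ω n) (hX : ∀ ω, Memℓp (X ω) 2) (m : ℕ) (n : ℤ × ℤ) :
    Measurable fun ω => cgmod m W (X ω) n :=
  (measurable_conv hW hXm hX _).norm

/-- The value at `x` is the discrete convolution at `0` of a translated sequence: countable
convergent sums of the coordinates of `X`. -/
theorem measurable_contConv {s : ℝ} (hs : 0 < s) {ξ : ℝ × ℝ} {κ : ℝ} {W : ℤ × ℤ → ℂ}
    (hW : W ∈ gaborFilters ξ κ) (hXm : ∀ n, Measurable fun ω => X ω n)
    (hX : ∀ ω, Memℓp (X ω) 2) (x : ℝ × ℝ) : Measurable fun ω => contConv s W (X ω) x := by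
  have h := measurable_conv hW (measurable_shift hs hXm hX (-(s⁻¹ • x)))
    (fun ω => memℓp_shift hs (hX ω) _) 0
  convert! h using 2 with ω
  rw [conv_eq_contConv hs hW (memℓp_shift hs (hX ω) _), contConv_shift hs hW (hX ω), smul_neg,
    smul_inv_smul₀ hs.ne']
  congr 1
  simp [toReal]

theorem measurable_l2norm {Y : Ω → ℤ × ℤ → ℝ} (hY : ∀ n, Measurable fun ω => Y ω n) :
    Measurable fun ω => l2norm (Y ω) := by
  simp_rw [l2norm_eq_tsum]
  exact (Measurable.tsum fun n => (hY n).enorm.pow_const 2).pow_const _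

theorem aemeasurable_l2norm {μ : Measure Ω} {Y : Ω → ℤ × ℤ → ℝ}
    (hY : ∀ n, AEMeasurable (fun ω => Y ω n) μ) : AEMeasurable (fun ω => l2norm (Y ω)) μ := by
  simp_rw [l2norm_eq_tsum]
  exact (AEMeasurable.tsum fun n => (hY n).enorm.pow_const 2).pow_const _

theorem measurable_discrepancy {s : ℝ} (hs : 0 < s) {ξ : ℝ × ℝ} {κ : ℝ} {W : ℤ × ℤ → ℂ}
    (hW : W ∈ gaborFilters ξ κ) (hXm : ∀ n, Measurable fun ω => X ω n)
    (hX : ∀ ω, Memℓp (X ω) 2) (m q : ℕ) (u : ℝ × ℝ) :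
    Measurable fun ω => discrepancy s m q W u (X ω) :=
  (measurable_l2norm fun n => (measurable_rgpool hW (measurable_shift hs hXm hX u)
    (fun ω => memℓp_shift hs (hX ω) u) m q n).sub (measurable_rgpool hW hXm hX m q n)).div
    (measurable_l2norm fun n => measurable_cgmod hW hXm hX (2 * m) n)

/-! ### Expectation of the normalized defect -/

variable {μ : Measure Ω}

/-- The normalizing sum involves the moduli at infinitely many points, so independence must pass
from finite vectors to whole families; finite-dimensional cylinders generate the product σ-algebra.
-/
theorem indepFun_modulus_unitPhase [IsProbabilityMeasure μ] {s : ℝ} (hs : 0 < s) {ξ : ℝ × ℝ} {κ : ℝ} {W : ℤ × ℤ → ℂ}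
    (hW : W ∈ gaborFilters ξ κ) (hXm : ∀ n, Measurable fun ω => X ω n)
    (hX : ∀ ω, Memℓp (X ω) 2) (hyp1 : UniformPhase μ s W X) (hyp2 : PhaseIndepModulus μ s W X)
    {ι : Type*} (p : ι → ℝ × ℝ) (x : ℝ × ℝ) :
    IndepFun (fun ω i => modulus s W (X ω) (p i)) (fun ω => unitPhase s W (X ω) x) μ := by
  refine IndepFun.process_indepFun₀ (X := fun i ω => modulus s W (X ω) (p i))
    (fun i => (measurable_contConv hs hW hXm hX _).norm.aemeasurable) (hyp1 x).aemeasurable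
    fun I => ?_
  -- A dummy point `0` is prepended because `I` may be empty while the hypothesis needs at least one
  -- point; `hφ` then projects it away.
  have h := hyp2 (Fintype.card I + 1) (Nat.le_add_left _ _) x
    (Fin.cons 0 fun j => p ((Fintype.equivFin I).symm j))
  have hφ : Measurable fun (f : Fin (Fintype.card I + 1) → ℝ) (i : I) =>
      f (Fin.succ (Fintype.equivFin I i)) :=
    measurable_pi_lambda _ fun i => measurable_pi_apply _
  have := h.comp hφ measurable_id
  simpa [Function.comp_def] using this

/-- Jensen for the square root, obtained as Cauchy–Schwarz against the constant `1`. -/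
theorem lintegral_rpow_half_le [IsProbabilityMeasure μ] {f : Ω → ℝ≥0∞} (hf : AEMeasurable f μ) :
    ∫⁻ ω, f ω ^ (1 / 2 : ℝ) ∂μ ≤ (∫⁻ ω, f ω ∂μ) ^ (1 / 2 : ℝ) := by
  have h := ENNReal.lintegral_mul_le_Lp_mul_Lq μ Real.HolderConjugate.two_two
    (hf.pow_const (1 / 2 : ℝ)) (aemeasurable_const (b := (1 : ℝ≥0∞)))
  simp only [Pi.mul_apply, mul_one, ← ENNReal.rpow_mul, ENNReal.one_rpow, lintegral_const,
    measure_univ] at h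
  simpa using h

/-- Separates modulus from phase at one point, the form required by independence; `s` cancels
between the frequency `ξ/s` and the step `m s k`. -/
theorem deltaOp_shift {s : ℝ} (hs : 0 < s) {ξ : ℝ × ℝ} {κ : ℝ} {W : ℤ × ℤ → ℂ}
    (hW : W ∈ gaborFilters ξ κ) {Y : ℤ × ℤ → ℝ} (hY : Memℓp Y 2) (m q : ℕ) (u : ℝ × ℝ)
    (n : ℤ × ℤ) :
    deltaOp s ξ m q W (shift s u Y) n =
      modulus s W Y ((2 * m * s) • toReal n - s • u) *
        phaseDefect q ((m : ℝ) • ξ) (unitPhase s W Y ((2 * m * s) • toReal n - s • u)) := by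
  rw [deltaOp, cgmod_shift hs hW hY, phaseDefect]
  have hp : ∀ x, phase s W (shift s u Y) x = phase s W Y (x - s • u) := fun x => by
    rw [phase, phase, contConv_shift hs hW hY]
  simp_rw [unitPhase, re_chi_mul_conj_exp, gFun, hp]
  have hd : ∀ k, dot (s⁻¹ • ξ) ((m * s) • toReal k) = dot ((m : ℝ) • ξ) (toReal k) := fun k => by
    simp only [dot, Prod.smul_fst, Prod.smul_snd, smul_eq_mul]
    field_simp
  simp_rw [hd]
  push_cast
  rfl

theorem aemeasurable_deltaOp_shift {s : ℝ} (hs : 0 < s) {ξ : ℝ × ℝ} {κ : ℝ} {W : ℤ × ℤ → ℂ}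
    (hW : W ∈ gaborFilters ξ κ) (hXm : ∀ n, Measurable fun ω => X ω n)
    (hX : ∀ ω, Memℓp (X ω) 2) (hyp1 : UniformPhase μ s W X) (m q : ℕ) (u : ℝ × ℝ) (n : ℤ × ℤ) :
    AEMeasurable (fun ω => deltaOp s ξ m q W (shift s u (X ω)) n) μ := by
  simp_rw [fun ω => deltaOp_shift hs hW (hX ω) m q u n]
  exact (measurable_contConv hs hW hXm hX _).norm.aemeasurable.mul
    ((continuous_phaseDefect q _).measurable.comp_aemeasurable (hyp1 _).aemeasurable)

/-- The expectation of the `ℓ²` norm of the defect, normalized by that of the modulus. -/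
theorem lintegral_l2norm_deltaOp_shift_div_le [IsProbabilityMeasure μ] {s : ℝ} (hs : 0 < s) {ξ : ℝ × ℝ} {κ : ℝ}
    {W : ℤ × ℤ → ℂ} (hW : W ∈ gaborFilters ξ κ) (hXm : ∀ n, Measurable fun ω => X ω n)
    (hX : ∀ ω, Memℓp (X ω) 2) (hyp1 : UniformPhase μ s W X) (hyp2 : PhaseIndepModulus μ s W X)
    (m q : ℕ) (u : ℝ × ℝ) :
    ∫⁻ ω, l2norm (deltaOp s ξ m q W (shift s u (X ω))) /
        l2norm (cgmod (2 * m) W (shift s u (X ω))) ∂μ ≤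
      ENNReal.ofReal (gammaFun q ((m : ℝ) • ξ)) := by
  set p : ℤ × ℤ → ℝ × ℝ := fun n => (2 * m * s) • toReal n - s • u with hp
  set A : ℤ × ℤ → Ω → ℝ≥0∞ := fun n ω => ‖modulus s W (X ω) (p n)‖ₑ ^ 2 with hA
  set B : ℤ × ℤ → Ω → ℝ≥0∞ := fun n ω =>
    ‖phaseDefect q ((m : ℝ) • ξ) (unitPhase s W (X ω) (p n))‖ₑ ^ 2 with hB
  have hnum : ∀ ω, l2norm (deltaOp s ξ m q W (shift s u (X ω))) =
      (∑' n, A n ω * B n ω) ^ (1 / 2 : ℝ) := fun ω => by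
    simp_rw [l2norm_eq_tsum, deltaOp_shift hs hW (hX ω), enorm_mul, mul_pow, hA, hB, hp]
  have hden : ∀ ω, l2norm (cgmod (2 * m) W (shift s u (X ω))) =
      (∑' n, A n ω) ^ (1 / 2 : ℝ) := fun ω => by
    simp_rw [l2norm_eq_tsum, cgmod_shift hs hW (hX ω), hA, hp]
    push_cast
    rfl
  have hAm : ∀ n, Measurable (A n) := fun n =>
    (measurable_contConv hs hW hXm hX _).norm.enorm.pow_const 2
  have hSm : Measurable fun ω => ∑' n, A n ω := Measurable.tsum hAm
  have hdm : Measurable fun z => ‖phaseDefect q ((m : ℝ) • ξ) z‖ₑ ^ 2 :=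
    (continuous_phaseDefect q _).measurable.enorm.pow_const 2
  have hBm : ∀ n, AEMeasurable (B n) μ := fun n => hdm.comp_aemeasurable (hyp1 _).aemeasurable
  have hBle : ∀ n, ∫⁻ ω, B n ω ∂μ ≤ ENNReal.ofReal (gammaFun q ((m : ℝ) • ξ)) ^ 2 := fun n => by
    refine le_trans (le_of_eq ?_) (lintegral_phaseDefect_sq_le q ((m : ℝ) • ξ))
    exact (hyp1 (p n)).lintegral_comp hdm.aemeasurable
  -- The weight is a measurable function of all the moduli, and `B n` of the phase at `p n` alone.
  -- No joint independence of the phases is needed, since the sum is treated term by term.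
  have hind : ∀ n, IndepFun (fun ω => A n ω / ∑' k, A k ω) (B n) μ := fun n => by
    have h := indepFun_modulus_unitPhase hs hW hXm hX hyp1 hyp2 p (p n)
    have hφ : Measurable fun f : ℤ × ℤ → ℝ => ‖f n‖ₑ ^ 2 / ∑' k, ‖f k‖ₑ ^ 2 :=
      ((measurable_pi_apply n).enorm.pow_const 2).div
        (Measurable.tsum fun k => (measurable_pi_apply k).enorm.pow_const 2)
    exact h.comp hφ hdm
  have hTm : AEMeasurable (fun ω => (∑' n, A n ω * B n ω) / ∑' n, A n ω) μ :=
    (AEMeasurable.tsum fun n => (hAm n).aemeasurable.mul (hBm n)).div hSm.aemeasurable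
  have hT : ∫⁻ ω, (∑' n, A n ω * B n ω) / ∑' n, A n ω ∂μ ≤
      ENNReal.ofReal (gammaFun q ((m : ℝ) • ξ)) ^ 2 := by
    have e : ∀ ω, (∑' n, A n ω * B n ω) / ∑' n, A n ω =
        ∑' n, A n ω / (∑' k, A k ω) * B n ω := fun ω => by
      rw [div_eq_mul_inv, ← ENNReal.tsum_mul_right]
      refine tsum_congr fun n => ?_
      rw [div_eq_mul_inv]
      ring
    simp_rw [e]
    rw [lintegral_tsum (f := fun n ω => A n ω / (∑' k, A k ω) * B n ω)
      fun n => ((hAm n).div hSm).aemeasurable.mul (hBm n)]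
    calc ∑' n, ∫⁻ ω, A n ω / (∑' k, A k ω) * B n ω ∂μ
        = ∑' n, (∫⁻ ω, A n ω / (∑' k, A k ω) ∂μ) * ∫⁻ ω, B n ω ∂μ :=
          tsum_congr fun n => lintegral_mul_eq_lintegral_mul_lintegral_of_indepFun''
            ((hAm n).div hSm).aemeasurable (hBm n) (hind n)
      _ ≤ ∑' n, (∫⁻ ω, A n ω / (∑' k, A k ω) ∂μ) *
            ENNReal.ofReal (gammaFun q ((m : ℝ) • ξ)) ^ 2 :=
          ENNReal.tsum_le_tsum fun n => mul_le_mul_right (hBle n) _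
      _ = (∫⁻ ω, (∑' n, A n ω) / (∑' k, A k ω) ∂μ) *
            ENNReal.ofReal (gammaFun q ((m : ℝ) • ξ)) ^ 2 := by
          rw [ENNReal.tsum_mul_right, ← lintegral_tsum
            (f := fun n ω => A n ω / ∑' k, A k ω) fun n => ((hAm n).div hSm).aemeasurable]
          simp_rw [div_eq_mul_inv, ENNReal.tsum_mul_right]
      _ ≤ 1 * ENNReal.ofReal (gammaFun q ((m : ℝ) • ξ)) ^ 2 := by
          gcongr
          -- The weights sum to at most `1`, including where the total is `0` or `∞` and the
          -- quotient is `0`.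
          refine (lintegral_mono (g := fun _ => 1) fun ω => ENNReal.div_self_le_one).trans ?_
          simp
      _ = _ := one_mul _
  simp_rw [hnum, hden, ← ENNReal.div_rpow_of_nonneg _ _ (by norm_num : (0 : ℝ) ≤ 1 / 2)]
  refine (lintegral_rpow_half_le hTm).trans ?_
  refine (ENNReal.rpow_le_rpow hT (by norm_num)).trans_eq ?_
  rw [← ENNReal.rpow_natCast, ← ENNReal.rpow_mul]
  norm_num

end RandomSequence

/-! ### Triangle inequality and assembly of the bound -/

theorem l2norm_add_le (Y Z : ℤ × ℤ → ℝ) : l2norm (Y + Z) ≤ l2norm Y + l2norm Z :=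
  eLpNorm_add_le (StronglyMeasurable.of_discrete).aestronglyMeasurable
    (StronglyMeasurable.of_discrete).aestronglyMeasurable (by norm_num)

theorem l2norm_sub_comm (Y Z : ℤ × ℤ → ℝ) : l2norm (Y - Z) = l2norm (Z - Y) :=
  eLpNorm_sub_comm _ _ _ _

end GaborPool

end

theorem mainTheorem2 {Ω : Type*} [MeasurableSpace Ω] (μ : Measure Ω) [IsProbabilityMeasure μ]
    (s : ℝ) (hs : 0 < s) (m q : ℕ) (hm : 1 ≤ m) (hq : 1 ≤ q)
    (ξ : ℝ × ℝ) (hξ : ξ ∈ Metric.closedBall (0 : ℝ × ℝ) Real.pi) (κ : ℝ) (hκ : 0 < κ)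
    (W : ℤ × ℤ → ℂ) (hW : W ∈ GaborPool.gaborFilters ξ κ)
    (X : Ω → ℤ × ℤ → ℝ) (hXmeas : ∀ n, Measurable fun ω => X ω n)
    (hX : ∀ ω, Memℓp (X ω) 2)
    (hyp1 : GaborPool.UniformPhase μ s W X)
    (hyp2 : GaborPool.PhaseIndepModulus μ s W X)
    (β : ℝ → ℝ) (hconj : GaborPool.ModPoolComparison s ξ κ m q W β)
    (u : ℝ × ℝ) (hκm : κ ≤ Real.pi / m) (hu : GaborPool.normOne u ≤ Real.pi / κ) :
    Measurable (fun ω => GaborPool.discrepancy s m q W u (X ω)) ∧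
      ∫⁻ ω, GaborPool.discrepancy s m q W u (X ω) ∂μ ≤
        ENNReal.ofReal
          (2 * (1 + β (m * κ)) * GaborPool.gammaFun q ((m : ℝ) • ξ)
            + GaborPool.alphaFun (κ • u)) := by
  open GaborPool in
  refine ⟨measurable_discrepancy hs hW hXmeas hX m q u, ?_⟩
  obtain ⟨hβ, -, hcomp⟩ := hconj
  have hb : 0 ≤ 1 + β (m * κ) := by have := hβ (m * κ) (by positivity); positivity
  set b := ENNReal.ofReal (1 + β (m * κ)) with hbdef
  set D : ℝ × ℝ → Ω → ℝ≥0∞ := fun v ω => l2norm (deltaOp s ξ m q W (shift s v (X ω))) /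
    l2norm (cgmod (2 * m) W (shift s v (X ω))) with hD
  have hDm : ∀ v, AEMeasurable (D v) μ := fun v =>
    (aemeasurable_l2norm fun n => aemeasurable_deltaOp_shift hs hW hXmeas hX hyp1 m q v n).div
      (measurable_l2norm fun n => measurable_cgmod hW (measurable_shift hs hXmeas hX v)
        (fun ω => memℓp_shift hs (hX ω) v) (2 * m) n).aemeasurable
  have hDle : ∀ v, ∫⁻ ω, D v ω ∂μ ≤ ENNReal.ofReal (gammaFun q ((m : ℝ) • ξ)) := fun v =>
    lintegral_l2norm_deltaOp_shift_div_le hs hW hXmeas hX hyp1 hyp2 m q v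
  have hpt : ∀ ω, discrepancy s m q W u (X ω) ≤
      b * D u ω + b * D 0 ω + ENNReal.ofReal (alphaFun (κ • u)) := by
    intro ω
    have hnum : l2norm (rgpool m q W (shift s u (X ω)) - rgpool m q W (X ω)) ≤
        b * l2norm (deltaOp s ξ m q W (shift s u (X ω))) +
          b * l2norm (deltaOp s ξ m q W (X ω)) +
          ENNReal.ofReal (alphaFun (κ • u)) * l2norm (cgmod (2 * m) W (X ω)) := by
      have e : rgpool m q W (shift s u (X ω)) - rgpool m q W (X ω) =
          (rgpool m q W (shift s u (X ω)) - cgmod (2 * m) W (shift s u (X ω))) +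
          (cgmod (2 * m) W (X ω) - rgpool m q W (X ω)) +
          (cgmod (2 * m) W (shift s u (X ω)) - cgmod (2 * m) W (X ω)) := by abel
      rw [e]
      refine (l2norm_add_le _ _).trans (add_le_add ((l2norm_add_le _ _).trans
        (add_le_add ?_ (hcomp _ (hX ω)))) (l2norm_cgmod_shift_sub_le hs hκ hW (hX ω) hm hκm u))
      rw [l2norm_sub_comm]
      exact hcomp _ (memℓp_shift hs (hX ω) u)
    rw [discrepancy]
    refine (ENNReal.div_le_div_right hnum _).trans ?_
    -- Translation invariance of the norm of `C_{2m}` makes the denominator of `D u` the common one,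
    -- so both defect terms become normalized quotients with the same bound in expectation.
    simp only [hD, shift_zero hs (hX ω), l2norm_cgmod_shift hs hW (hX ω) hm hκm u,
      ENNReal.add_div, mul_div_assoc]
    gcongr
    exact mul_le_of_le_one_right' ENNReal.div_self_le_one
  calc ∫⁻ ω, discrepancy s m q W u (X ω) ∂μ
      ≤ ∫⁻ ω, b * D u ω + b * D 0 ω + ENNReal.ofReal (alphaFun (κ • u)) ∂μ := lintegral_mono hpt
    _ = b * ∫⁻ ω, D u ω ∂μ + b * ∫⁻ ω, D 0 ω ∂μ + ENNReal.ofReal (alphaFun (κ • u)) := by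
        rw [lintegral_add_right _ measurable_const, lintegral_add_left' ((hDm u).const_mul b),
          lintegral_const_mul'' _ (hDm u), lintegral_const_mul'' _ (hDm 0)]
        simp
    _ ≤ b * ENNReal.ofReal (gammaFun q ((m : ℝ) • ξ)) +
          b * ENNReal.ofReal (gammaFun q ((m : ℝ) • ξ)) +
          ENNReal.ofReal (alphaFun (κ • u)) := by
        gcongr
        · exact hDle u
        · exact hDle 0
    _ = _ := by
        have hγ : 0 ≤ gammaFun q ((m : ℝ) • ξ) := Real.sqrt_nonneg _
        have hα : 0 ≤ alphaFun (κ • u) := by unfold alphaFun normOne; positivity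
        rw [hbdef, ← ENNReal.ofReal_mul hb, ← ENNReal.ofReal_add (by positivity) (by positivity),
          ← ENNReal.ofReal_add (by positivity) hα]
        congr 1
        ring
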